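/- **Soundness of the denotational semantics of shift/reset in guarded interaction trees.** *Language.* Expressions, values and evaluation contexts are $$e ::= v \mid x \mid e_1\,e_2 \mid e_1\oplus e_2 \mid \mathsf{if}\ e_1\ \mathsf{then}\ e_2\ \mathsf{else}\ e_3 \mid \mathsf{shift}\ x.\,e \mid \mathsf{reset}\ e \mid e_1\,@\,e_2,\qquad v ::= n \mid \mathsf{rec}\,f\,x = e \mid \mathsf{cont}\,K,$$ $$K ::= \square \mid K[\mathsf{if}\ \square\ \mathsf{then}\ e_1\ \mathsf{else}\ e_2] \mid K[v\,\square] \mid K[\square\,e] \mid K[e\oplus\square] \mid K[\square\oplus v] \mid K[\square\,@\,v] \mid K[e\,@\,\square],$$ where $n\in\mathbb N$ and $\oplus$ is any binary operation on $\mathbb N$. A metacontinuation $mk$ is a list of contexts. Configurations are $\langle e,K,mk\rangle_{\mathsf{eval}}$, $\langle K,v,mk\rangle_{\mathsf{cont}}$, $\langle mk,v\rangle_{\mathsf{mcont}}$, $\langle e\rangle_{\mathsf{term}}$, $\langle v\rangle_{\mathsf{ret}}$. The abstract machine has the steps - $\langle e\rangle_{\mathsf{term}}\mapsto\langle e,\square,[]\rangle_{\mathsf{eval}}$;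 $\langle K{::}mk,v\rangle_{\mathsf{mcont}}\mapsto\langle K,v,mk\rangle_{\mathsf{cont}}$; $\langle [],v\rangle_{\mathsf{mcont}}\mapsto\langle v\rangle_{\mathsf{ret}}$; $\langle\square,v,mk\rangle_{\mathsf{cont}}\mapsto\langle mk,v\rangle_{\mathsf{mcont}}$; - $\langle v,K,mk\rangle_{\mathsf{eval}}\mapsto\langle K,v,mk\rangle_{\mathsf{cont}}$; $\langle \mathsf{reset}\ e,K,mk\rangle_{\mathsf{eval}}\mapsto\langle e,\square,K{::}mk\rangle_{\mathsf{eval}}$; $\langle \mathsf{shift}\ x.\,e,K,mk\rangle_{\mathsf{eval}}\mapsto\langle e[\mathsf{cont}\,K/x],\square,mk\rangle_{\mathsf{eval}}$; - $\langle e_0\,@\,e_1,K,mk\rangle_{\mathsf{eval}}\mapsto\langle e_1,K[e_0\,@\,\square],mk\rangle_{\mathsf{eval}}$; $\langle K[e\,@\,\square],v,mk\rangle_{\mathsf{cont}}\mapsto\langle e,K[\square\,@\,v],mk\rangle_{\mathsf{eval}}$; $\langle K[\square\,@\,v],\mathsf{cont}\,K',mk\rangle_{\mathsf{cont}}\mapsto\langle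 K',v,K{::}mk\rangle_{\mathsf{cont}}$; - $\langle e_0\,e_1,K,mk\rangle_{\mathsf{eval}}\mapsto\langle e_0,K[\square\,e_1],mk\rangle_{\mathsf{eval}}$; $\langle K[\square\,e],v,mk\rangle_{\mathsf{cont}}\mapsto\langle e,K[v\,\square],mk\rangle_{\mathsf{eval}}$; $\langle K[(\mathsf{rec}\,f\,x=e)\,\square],v,mk\rangle_{\mathsf{cont}}\mapsto\langle e[v/x,(\mathsf{rec}\,f\,x=e)/f],K,mk\rangle_{\mathsf{eval}}$; - $\langle e_0\oplus e_1,K,mk\rangle_{\mathsf{eval}}\mapsto\langle e_1,K[e_0\oplus\square],mk\rangle_{\mathsf{eval}}$; $\langle K[e\oplus\square],v,mk\rangle_{\mathsf{cont}}\mapsto\langle e,K[\square\oplus v],mk\rangle_{\mathsf{eval}}$; $\langle K[\square\oplus n],m,mk\rangle_{\mathsf{cont}}\mapsto\langle m\oplus n,K,mk\rangle_{\mathsf{eval}}$; - $\langle \mathsf{if}\ e\ \mathsf{then}\ e_1\ \mathsf{else}\ e_2,K,mk\rangle_{\mathsf{eval}}\mapsto\langle e,K[\mathsf{if}\ \square\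 \mathsf{then}\ e_1\ \mathsf{else}\ e_2],mk\rangle_{\mathsf{eval}}$; $\langle K[\mathsf{if}\ \square\ \mathsf{then}\ e_1\ \mathsf{else}\ e_2],n,mk\rangle_{\mathsf{cont}}\mapsto\langle e_i,K,mk\rangle_{\mathsf{eval}}$ with $i=1$ if $n\neq0$ and $i=2$ if $n=0$. *Semantic domain.* Types are complete ordered families of equivalences, functions are non-expansive, and ${\blacktriangleright}$ is the later modality with $\mathsf{Next}:X\to{\blacktriangleright}X$. Let $\mathrm{IT}$ be the solution of the guarded equation $$\mathrm{IT}\;\cong\;\mathbb N+{\blacktriangleright}(\mathrm{IT}\to\mathrm{IT})+\mathrm{Error}+{\blacktriangleright}\mathrm{IT}+\sum_i \mathrm{Ins}_i(\mathrm{IT})\times(\mathrm{Outs}_i(\mathrm{IT})\to{\blacktriangleright}\mathrm{IT}),$$ with constructors $\mathsf{Ret},\mathsf{Fun},\mathsf{Err},\mathsf{Tau},\mathsf{Vis}_i$ and $\mathsf{Tick}=\mathsf{Tau}\circ\mathsf{Next}$, for the effects $i\in\{\mathsf{reset},\mathsf{shift},\mathsf{pop},\mathsf{appcont}\}$ with $\mathrm{Ins}_{\mathsf{reset}}(X)=\mathrm{Ins}_{\mathsf{pop}}(X)={\blacktriangleright}X$,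 $\mathrm{Ins}_{\mathsf{shift}}(X)=({\blacktriangleright}X\to{\blacktriangleright}X)\to{\blacktriangleright}X$, $\mathrm{Ins}_{\mathsf{appcont}}(X)={\blacktriangleright}X\times{\blacktriangleright}(X\to X)$, $\mathrm{Outs}_{\mathsf{pop}}(X)=0$, and $\mathrm{Outs}_i(X)={\blacktriangleright}X$ for the other three effects. The state is a list of continuations ${\blacktriangleright}\mathrm{IT}\to{\blacktriangleright}\mathrm{IT}$, and the reifiers are $$r_{\mathsf{reset}}(e,\sigma,\kappa)=(e,\kappa{::}\sigma),\quad r_{\mathsf{shift}}(f,\sigma,\kappa)=(f\,\kappa,\sigma),\quad r_{\mathsf{pop}}(e,[],\_)=(e,[]),$$ $$r_{\mathsf{pop}}(e,\kappa{::}\sigma,\_)=(\kappa\,e,\sigma),\quad r_{\mathsf{appcont}}((e,g),\sigma,\kappa')=(g\,e,\kappa'{::}\sigma).$$ The relation $(\alpha,\sigma)\rightsquigarrow(\beta,\sigma')$ holds iff either $\alpha=\mathsf{Tick}(\beta)$ and $\sigma=\sigma'$, or $\alpha=\mathsf{Vis}_i(x,k)$ with $r_i(x,\sigma,k)=(\mathsf{Next}(\beta),\sigma')$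 for some $i,x,k$; $\rightsquigarrow^*$ is its reflexive-transitive closure. *Denotation.* Let $\mathsf{getval}(\alpha,f)$ (resp. $\mathsf{getret}$, $\mathsf{getfun}$) evaluate $\alpha$ to a value $\mathsf{Ret}(n)$ or $\mathsf{Fun}(g)$, commuting with $\mathsf{Tau}$, $\mathsf{Vis}$ and $\mathsf{Err}$, and pass the value (resp. the number $n$; the function $g$) to $f$, with result $\mathsf{Err}(\mathsf{RunTime})$ if the value is not of that kind. Let $\alpha\odot\beta$ be call-by-value application, with $\mathsf{Fun}(\mathsf{Next}\,g)\odot v=\mathsf{Tick}(g\,v)$ for values $v$; let $\mathsf{Pop}(\beta)=\mathsf{getval}(\beta,\lambda v.\,\mathsf{Vis}_{\mathsf{pop}}(\mathsf{Next}\,v,!))$, where $!$ is the map out of the empty type. For an environment $\rho:\mathrm{Var}\to\mathrm{IT}$, and writing $\mathsf{Vis}_i(x)$ for $\mathsf{Vis}_i(x,\mathrm{id})$: - $[\![x]\!]_\rho=\rho(x)$; $[\![n]\!]_\rho=\mathsf{Ret}(n)$; $[\![\mathsf{rec}\,f\,x=e]\!]_\rho$ is the guarded fixed point $\varphi=\mathsf{Fun}(\mathsf{Next}(\lambda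 v.\,[\![e]\!]_{\rho,f\mapsto\varphi,x\mapsto v}))$; $[\![\mathsf{cont}\,K]\!]_\rho=\mathsf{Fun}(\mathsf{Next}(\lambda y.\,\mathsf{Tick}(\mathsf{Pop}([\![K]\!]_\rho\,y))))$; - $[\![e_1\,e_2]\!]_\rho=\mathsf{getval}([\![e_1]\!]_\rho,\lambda f.\,\mathsf{getval}([\![e_2]\!]_\rho,\lambda y.\,f\odot y))$; $[\![e_1\oplus e_2]\!]_\rho$ evaluates $[\![e_2]\!]_\rho$, then $[\![e_1]\!]_\rho$, to values and applies $\oplus$ if both are numbers, with result $\mathsf{Err}(\mathsf{RunTime})$ otherwise; $[\![\mathsf{if}\ e\ \mathsf{then}\ e_1\ \mathsf{else}\ e_2]\!]_\rho=\mathsf{getret}([\![e]\!]_\rho,\lambda n.\,[\![e_1]\!]_\rho\text{ if }n\ne0,\ [\![e_2]\!]_\rho\text{ if }n=0)$; - $[\![\mathsf{reset}\ e]\!]_\rho=\mathsf{Vis}_{\mathsf{reset}}(\mathsf{Next}(\mathsf{Pop}[\![e]\!]_\rho))$; $[\![\mathsf{shift}\ x.\,e]\!]_\rho=\mathsf{Vis}_{\mathsf{shift}}(\lambda\kappa.\,\mathsf{Next}(\mathsf{Pop}[\![e]\!]_{\rho,\,x\mapsto\mathsf{Fun}(\mathsf{Next}(\lambda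 y.\,\mathsf{Tau}(\kappa(\mathsf{Next}\,y))))}))$; $[\![e_1\,@\,e_2]\!]_\rho=\mathsf{getval}([\![e_2]\!]_\rho,\lambda y.\,\mathsf{getfun}([\![e_1]\!]_\rho,\lambda g.\,\mathsf{Vis}_{\mathsf{appcont}}(\mathsf{Next}\,y,g)))$; - $[\![\square]\!]_\rho=\mathrm{id}$, and for a frame $F$, $[\![K[F]]\!]_\rho=\lambda y.\,[\![K]\!]_\rho(F_\rho(y))$, where $F_\rho(y)$ is the clause above for $F$ with $y$ as the denotation of the hole; $[\![mk]\!]_\rho$ is the list of the continuations ${\blacktriangleright}(\mathsf{Pop}\circ[\![K]\!]_\rho)$, $K\in mk$; - $[\![\langle e,K,mk\rangle_{\mathsf{eval}}]\!]_\rho=(\mathsf{Pop}[\![K[e]]\!]_\rho,[\![mk]\!]_\rho)$; $[\![\langle K,v,mk\rangle_{\mathsf{cont}}]\!]_\rho=(\mathsf{Pop}[\![K[v]]\!]_\rho,[\![mk]\!]_\rho)$; $[\![\langle mk,v\rangle_{\mathsf{mcont}}]\!]_\rho=(\mathsf{Pop}[\![v]\!]_\rho,[\![mk]\!]_\rho)$;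 $[\![\langle e\rangle_{\mathsf{term}}]\!]_\rho=(\mathsf{Pop}[\![e]\!]_\rho,[])$; $[\![\langle v\rangle_{\mathsf{ret}}]\!]_\rho=([\![v]\!]_\rho,[])$. **Theorem.** Let $c_0,c_1$ be configurations with $c_0\mapsto c_1$. Then for every environment $\rho$, $$[\![c_0]\!]_\rho\rightsquigarrow^*[\![c_1]\!]_\rho .$$ -/

import Mathlib

noncomputable section

namespace GITree

/-! ## Ordered families of equivalences

The standard model of the guarded type theory underlying Iris: types are complete ordered
families of equivalences and functions are non-expansive maps. -/

/-- Ordered families of equivalences; `dist n x y` is equality of `x` and `y` at time `n`. -/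
class OFE (α : Type) where
  dist : ℕ → α → α → Prop
  dist_equiv : ∀ n, Equivalence (dist n)
  dist_mono : ∀ {n m : ℕ} {x y : α}, m ≤ n → dist n x y → dist m x y
  eq_of_dist : ∀ {x y : α}, (∀ n, dist n x y) → x = y

open OFE (dist)

theorem drefl {α : Type} [OFE α] (n : ℕ) (x : α) : dist n x x := (OFE.dist_equiv n).refl x
theorem dsymm {α : Type} [OFE α] {n : ℕ} {x y : α} (h : dist n x y) : dist n y x :=
  (OFE.dist_equiv n).symm h
theorem dtrans {α : Type} [OFE α] {n : ℕ} {x y z : α} (h : dist n x y) (h' : dist n y z) :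
    dist n x z := (OFE.dist_equiv n).trans h h'
theorem dist_of_eq {α : Type} [OFE α] {x y : α} (h : x = y) (n : ℕ) : dist n x y := h ▸ drefl n x

/-- Complete ordered families of equivalences: every Cauchy chain has a limit. -/
class COFE (α : Type) extends OFE α where
  complete : ∀ c : ℕ → α, (∀ n, dist n (c (n + 1)) (c n)) → ∃ x, ∀ n, dist n x (c n)

/-- Cauchy chains. -/
def IsChain {α : Type} [OFE α] (c : ℕ → α) : Prop := ∀ n, dist n (c (n + 1)) (c n)

theorem IsChain.le {α : Type} [OFE α] {c : ℕ → α} (hc : IsChain c) {n m : ℕ} (h : n ≤ m) :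
    dist n (c m) (c n) := by
  induction m, h using Nat.le_induction with
  | base => exact drefl _ _
  | succ k hk ih => exact dtrans (OFE.dist_mono hk (hc k)) ih

/-- The limit of a Cauchy chain. -/
def lim {α : Type} [COFE α] (c : ℕ → α) (hc : IsChain c) : α := (COFE.complete c hc).choose

theorem lim_spec {α : Type} [COFE α] (c : ℕ → α) (hc : IsChain c) (n : ℕ) :
    dist n (lim c hc) (c n) := (COFE.complete c hc).choose_spec n

/-- Equality at all strictly earlier times. -/
def DistLater {α : Type} [OFE α] (n : ℕ) (x y : α) : Prop := ∀ m, m < n → dist m x y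

theorem DistLater.of_dist {α : Type} [OFE α] {n : ℕ} {x y : α} (h : dist n x y) :
    DistLater n x y := fun _ hm => OFE.dist_mono hm.le h

/-! ### Non-expansive maps -/

/-- Non-expansive maps. -/
structure NEHom (α β : Type) [OFE α] [OFE β] where
  toFun : α → β
  ne : ∀ {n : ℕ} {x y : α}, dist n x y → dist n (toFun x) (toFun y)

infixr:25 " -n> " => NEHom

instance {α β : Type} [OFE α] [OFE β] : CoeFun (α -n> β) (fun _ => α → β) := ⟨NEHom.toFun⟩

theorem NEHom.ext {α β : Type} [OFE α] [OFE β] {f g : α -n> β} (h : ∀ x, f x = g x) : f = g := by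
  cases f; cases g; congr; exact funext h

namespace NEHom

protected def id {α : Type} [OFE α] : α -n> α := ⟨fun x => x, fun h => h⟩

protected def comp {α β γ : Type} [OFE α] [OFE β] [OFE γ] (g : β -n> γ) (f : α -n> β) : α -n> γ :=
  ⟨fun x => g (f x), fun h => g.ne (f.ne h)⟩

protected def const {α β : Type} [OFE α] [OFE β] (b : β) : α -n> β := ⟨fun _ => b, fun _ => drefl _ b⟩

instance {α β : Type} [OFE α] [OFE β] : OFE (α -n> β) where
  dist n f g := ∀ x, dist n (f x) (g x)
  dist_equiv n := ⟨fun f x => drefl n (f x), fun h x => dsymm (h x), fun h h' x => dtrans (h x) (h' x)⟩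
  dist_mono hm h x := OFE.dist_mono hm (h x)
  eq_of_dist h := NEHom.ext fun x => OFE.eq_of_dist fun n => h n x

instance {α β : Type} [OFE α] [OFE β] [Inhabited β] : Inhabited (α -n> β) := ⟨NEHom.const default⟩

instance {α β : Type} [OFE α] [COFE β] : COFE (α -n> β) where
  complete c hc := by
    have hx : ∀ x, IsChain fun n => c n x := fun x n => hc n x
    refine ⟨⟨fun x => lim (fun n => c n x) (hx x), ?_⟩, fun n x => lim_spec _ (hx x) n⟩
    intro n x y h
    exact dtrans (lim_spec _ (hx x) n) (dtrans ((c n).ne h) (dsymm (lim_spec _ (hx y) n)))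

theorem dist_app {α β : Type} [OFE α] [OFE β] {n : ℕ} {f g : α -n> β} {x y : α}
    (h : dist n f g) (h' : dist n x y) : dist n (f x) (g y) := dtrans (h x) (g.ne h')

end NEHom

/-! ### Basic types -/

instance : COFE Unit where
  dist _ _ _ := True
  dist_equiv _ := ⟨fun _ => trivial, fun _ => trivial, fun _ _ => trivial⟩
  dist_mono _ _ := trivial
  eq_of_dist _ := rfl
  complete _ _ := ⟨(), fun _ => trivial⟩

instance : COFE Empty where
  dist _ _ _ := True
  dist_equiv _ := ⟨fun _ => trivial, fun _ => trivial, fun _ _ => trivial⟩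
  dist_mono _ _ := trivial
  eq_of_dist {x _} _ := x.elim
  complete c _ := (c 0).elim

instance {α β : Type} [OFE α] [OFE β] : OFE (α × β) where
  dist n x y := dist n x.1 y.1 ∧ dist n x.2 y.2
  dist_equiv n := ⟨fun x => ⟨drefl n x.1, drefl n x.2⟩, fun h => ⟨dsymm h.1, dsymm h.2⟩,
    fun h h' => ⟨dtrans h.1 h'.1, dtrans h.2 h'.2⟩⟩
  dist_mono hm h := ⟨OFE.dist_mono hm h.1, OFE.dist_mono hm h.2⟩
  eq_of_dist h := Prod.ext (OFE.eq_of_dist fun n => (h n).1) (OFE.eq_of_dist fun n => (h n).2)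

instance {α β : Type} [COFE α] [COFE β] : COFE (α × β) where
  complete c hc := by
    obtain ⟨x, hx⟩ := COFE.complete (fun n => (c n).1) (fun n => (hc n).1)
    obtain ⟨y, hy⟩ := COFE.complete (fun n => (c n).2) (fun n => (hc n).2)
    exact ⟨(x, y), fun n => ⟨hx n, hy n⟩⟩

instance {ι β : Type} [OFE β] : OFE (ι → β) where
  dist n f g := ∀ i, dist n (f i) (g i)
  dist_equiv n := ⟨fun f x => drefl n (f x), fun h x => dsymm (h x), fun h h' x => dtrans (h x) (h' x)⟩
  dist_mono hm h x := OFE.dist_mono hm (h x)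
  eq_of_dist h := funext fun x => OFE.eq_of_dist fun n => h n x

/-- Two options are equal at time `n` if both are `none`, or both are `some` of elements that
are equal at time `n`. -/
instance {α : Type} [OFE α] : OFE (Option α) where
  dist n := Option.Rel (dist n)
  dist_equiv n := by
    refine ⟨fun x => ?_, fun {x y} h => ?_, fun {x y z} h h' => ?_⟩
    · cases x
      · exact .none
      · exact .some (drefl n _)
    · cases h with
      | none => exact .none
      | some h => exact .some (dsymm h)
    · cases h with
      | none => exact h'
      | some h => cases h' with | some h' => exact .some (dtrans h h')
  dist_mono hm h := by
    cases h with
    | none => exact .none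
    | some h => exact .some (OFE.dist_mono hm h)
  eq_of_dist {x y} h := by
    cases x <;> cases y
    · rfl
    · cases h 0
    · cases h 0
    · congr 1
      exact OFE.eq_of_dist fun n => by cases h n; assumption

/-- Two lists are equal at time `n` if they have the same length and are equal at time `n`
elementwise. -/
instance {α : Type} [OFE α] : OFE (List α) where
  dist n := List.Forall₂ (dist n)
  dist_equiv n := by
    refine ⟨fun x => ?_, fun {x y} h => ?_, fun {x y z} h h' => ?_⟩
    · exact List.forall₂_same.2 fun a _ => drefl n a
    · exact List.Forall₂.flip (h.imp fun _ _ h => dsymm h)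
    · induction h generalizing z with
      | nil => exact h'
      | cons h _ ih => cases h' with | cons h₁ h₂ => exact .cons (dtrans h h₁) (ih h₂)
  dist_mono hm h := h.imp fun _ _ h => OFE.dist_mono hm h
  eq_of_dist {x y} h := by
    induction x generalizing y with
    | nil => cases h 0; rfl
    | cons a l ih =>
      cases y with
      | nil => cases h 0
      | cons b l' =>
        congr 1
        · exact OFE.eq_of_dist fun n => by cases h n; assumption
        · exact ih fun n => by cases h n; assumption

/-! ### The later modality -/

/-- The later modality on types. -/
structure Later (α : Type) where
  next ::
  val : α

namespace Later

instance {α : Type} [OFE α] : OFE (Later α) where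
  dist n x y := DistLater n x.val y.val
  dist_equiv n := ⟨fun x m _ => drefl m x.val, fun h m hm => dsymm (h m hm),
    fun h h' m hm => dtrans (h m hm) (h' m hm)⟩
  dist_mono hm h k hk := h k (hk.trans_le hm)
  eq_of_dist {x y} h := by
    cases x; cases y; congr 1
    exact OFE.eq_of_dist fun n => h (n + 1) n (Nat.lt_succ_self n)

instance {α : Type} [COFE α] : COFE (Later α) where
  complete c hc := by
    have h : IsChain fun n => (c (n + 1)).val := fun n => hc (n + 1) n (Nat.lt_succ_self n)
    refine ⟨⟨lim _ h⟩, fun n m hm => ?_⟩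
    exact dtrans (lim_spec _ h m) (dsymm (IsChain.le hc (Nat.succ_le_of_lt hm) m (Nat.lt_succ_self m)))

/-- The functorial action of the later modality. -/
protected def map {α β : Type} [OFE α] [OFE β] (f : α -n> β) : Later α -n> Later β :=
  ⟨fun x => ⟨f x.val⟩, fun h m hm => f.ne (h m hm)⟩

theorem map_contractive {α β : Type} [OFE α] [OFE β] {n : ℕ} {f g : α -n> β}
    (h : DistLater n f g) : dist n (Later.map f) (Later.map g) := fun x m hm => h m hm x.val

end Later

/-! ### Guarded fixed points -/

/-- A map is contractive if its value at time `n` depends only on its argument at earlier times;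
these are the maps that factor through `Later`. -/
def Contractive {α : Type} [OFE α] (f : α → α) : Prop :=
  ∀ {n : ℕ} {x y : α}, DistLater n x y → dist n (f x) (f y)

theorem fixChain {α : Type} [OFE α] [Inhabited α] (f : α → α) (hf : Contractive f) :
    IsChain fun n => f^[n + 1] default := by
  have h : ∀ n, dist n (f (f^[n + 1] default)) (f^[n + 1] default) := by
    intro n
    induction n with
    | zero => exact hf fun m hm => absurd hm (Nat.not_lt_zero m)
    | succ n ih =>
      rw [Function.iterate_succ_apply' f (n + 1)]
      exact hf fun m hm => OFE.dist_mono (Nat.le_of_lt_succ hm) ih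
  intro n
  change dist n (f^[n + 1 + 1] default) _
  rw [Function.iterate_succ_apply' f (n + 1)]
  exact h n

/-- The guarded fixed point combinator. -/
def fixp {α : Type} [COFE α] [Inhabited α] (f : α → α) (hf : Contractive f) : α :=
  lim _ (fixChain f hf)

theorem fixp_eq {α : Type} [COFE α] [Inhabited α] (f : α → α) (hf : Contractive f) :
    fixp f hf = f (fixp f hf) := by
  refine OFE.eq_of_dist fun n => ?_
  refine dtrans (OFE.dist_mono n.le_succ (lim_spec _ (fixChain f hf) (n + 1))) ?_
  simp only [Function.iterate_succ_apply' f (n + 1)]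
  exact hf (DistLater.of_dist (dsymm (lim_spec _ (fixChain f hf) n)))

/-! ## Guarded recursive types -/

/-- Locally contractive functors of mixed variance: the type expressions with one type variable
all of whose occurrences are guarded by `Later`. The action on morphisms takes a map in each
direction. -/
structure GFunctor where
  obj : (X : Type) → [COFE X] → Type
  inst : (X : Type) → [COFE X] → COFE (obj X)
  map : {X Y : Type} → [COFE X] → [COFE Y] → (Y -n> X) → (X -n> Y) → (obj X -n> obj Y)
  map_id : ∀ {X : Type} [COFE X] (u : obj X), map NEHom.id NEHom.id u = u
  map_comp : ∀ {X Y Z : Type} [COFE X] [COFE Y] [COFE Z] (p : Y -n> X) (e : X -n> Y)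
    (q : Z -n> Y) (d : Y -n> Z) (u : obj X), map (p.comp q) (d.comp e) u = map q d (map p e u)
  contractive : ∀ {X Y : Type} [COFE X] [COFE Y] {n : ℕ} {p q : Y -n> X} {e d : X -n> Y},
    DistLater n p q → DistLater n e d → dist n (map p e) (map q d)

instance (F : GFunctor) (X : Type) [COFE X] : COFE (F.obj X) := F.inst X

namespace GFunctor

/-- The constant functor. -/
abbrev const (A : Type) [COFE A] : GFunctor where
  obj _ _ := A
  inst _ _ := inferInstance
  map _ _ := NEHom.id
  map_id _ := rfl
  map_comp _ _ _ _ _ := rfl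
  contractive _ _ x := drefl _ x

/-- `X ↦ ▶ X`. -/
abbrev later : GFunctor where
  obj X _ := Later X
  inst _ _ := inferInstance
  map _ e := Later.map e
  map_id _ := rfl
  map_comp _ _ _ _ _ := rfl
  contractive _ he := Later.map_contractive he

/-- `X ↦ ▶ (X → X)`. -/
abbrev laterEndo : GFunctor where
  obj X _ := Later (X -n> X)
  inst _ _ := inferInstance
  map p e := Later.map ⟨fun f => e.comp (f.comp p), fun h x => e.ne (h (p x))⟩
  map_id _ := rfl
  map_comp _ _ _ _ _ := rfl
  contractive hp he := Later.map_contractive fun m hm f x =>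
    dtrans (he m hm _) (NEHom.ne _ (f.ne (hp m hm x)))

/-- `X ↦ F X × G X`. -/
abbrev prod (F G : GFunctor) : GFunctor where
  obj X _ := F.obj X × G.obj X
  inst _ _ := inferInstance
  map p e := ⟨fun u => (F.map p e u.1, G.map p e u.2), fun h => ⟨(F.map p e).ne h.1, (G.map p e).ne h.2⟩⟩
  map_id u := Prod.ext (F.map_id u.1) (G.map_id u.2)
  map_comp p e q d u := Prod.ext (F.map_comp p e q d u.1) (G.map_comp p e q d u.2)
  contractive hp he u := ⟨F.contractive hp he u.1, G.contractive hp he u.2⟩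

/-- `X ↦ (F X → G X)`. -/
abbrev hom (F G : GFunctor) : GFunctor where
  obj X _ := F.obj X -n> G.obj X
  inst _ _ := inferInstance
  map p e := ⟨fun f => (G.map p e).comp (f.comp (F.map e p)),
    fun h x => (G.map p e).ne (h (F.map e p x))⟩
  map_id f := NEHom.ext fun x => (G.map_id _).trans (congrArg f (F.map_id x))
  map_comp p e q d f := NEHom.ext fun x => by
    refine (G.map_comp p e q d _).trans ?_
    exact congrArg (fun z => G.map q d (G.map p e (f z))) (F.map_comp d q e p x)
  contractive hp he f x := dtrans (G.contractive hp he _) (NEHom.ne _ (f.ne (F.contractive he hp x)))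

end GFunctor

/-! ### The solution of the guarded domain equation `X ≅ F X`

It is built, in the way of America and Rutten, as the limit of the tower
`1 ← F 1 ← F (F 1) ← ⋯`. -/

namespace Sol

structure CObj where
  carrier : Type
  inst : COFE carrier

def tower (F : GFunctor) : ℕ → CObj
  | 0 => ⟨Unit, inferInstance⟩
  | k + 1 => letI := (tower F k).inst; ⟨F.obj (tower F k).carrier, inferInstance⟩

/-- The `k`-th approximation. -/
abbrev T (F : GFunctor) (k : ℕ) : Type := (tower F k).carrier

instance (F : GFunctor) (k : ℕ) : COFE (T F k) := (tower F k).inst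

variable (F : GFunctor) (b : F.obj Unit)

/-- The embedding into the next approximation and the projection back; the point `b` serves only
to start the embeddings. -/
def upDown : (k : ℕ) → (T F k -n> T F (k + 1)) × (T F (k + 1) -n> T F k)
  | 0 => (NEHom.const b, NEHom.const ())
  | k + 1 => (F.map (upDown k).2 (upDown k).1, F.map (upDown k).1 (upDown k).2)

abbrev up (k : ℕ) : T F k -n> T F (k + 1) := (upDown F b k).1
abbrev down (k : ℕ) : T F (k + 1) -n> T F k := (upDown F b k).2

/-- The canonical map between any two approximations. -/
def conn : (n k : ℕ) → (T F n -n> T F k)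
  | _, 0 => NEHom.const ()
  | 0, k + 1 => (up F b k).comp (conn 0 k)
  | n + 1, k + 1 => F.map (conn k n) (conn n k)
termination_by n k => n + k

theorem conn_zero (k : ℕ) : conn F b 0 (k + 1) = (up F b k).comp (conn F b 0 k) := by rw [conn]

theorem conn_succ (n k : ℕ) :
    conn F b (n + 1) (k + 1) = F.map (conn F b k n) (conn F b n k) := by rw [conn]

theorem fcomp {X Y Z : Type} [COFE X] [COFE Y] [COFE Z] (p : Y -n> X) (e : X -n> Y)
    (q : Z -n> Y) (d : Y -n> Z) : (F.map q d).comp (F.map p e) = F.map (p.comp q) (d.comp e) :=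
  NEHom.ext fun u => (F.map_comp p e q d u).symm

theorem fid {X : Type} [COFE X] : F.map (NEHom.id (α := X)) NEHom.id = NEHom.id :=
  NEHom.ext fun u => F.map_id u

theorem to_zero {X : Type} [OFE X] (f g : X -n> T F 0) : f = g := NEHom.ext fun _ => rfl

theorem down_up (k : ℕ) : (down F b k).comp (up F b k) = NEHom.id := by
  induction k with
  | zero => exact to_zero F _ _
  | succ k ih =>
    refine (fcomp F _ _ _ _).trans ?_
    change F.map ((down F b k).comp (up F b k)) ((down F b k).comp (up F b k)) = _
    rw [ih]; exact fid F

theorem up_down (k : ℕ) : dist k ((up F b (k + 1)).comp (down F b (k + 1))) NEHom.id := by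
  induction k with
  | zero =>
    have h : (up F b 1).comp (down F b 1) = F.map ((up F b 0).comp (down F b 0))
      ((up F b 0).comp (down F b 0)) := fcomp F _ _ _ _
    rw [h]
    refine dtrans (F.contractive (q := NEHom.id) (d := NEHom.id) ?_ ?_) (dist_of_eq (fid F) 0) <;>
      exact fun m hm => absurd hm (Nat.not_lt_zero m)
  | succ k ih =>
    have h : (up F b (k + 2)).comp (down F b (k + 2)) = F.map ((up F b (k + 1)).comp (down F b (k + 1)))
      ((up F b (k + 1)).comp (down F b (k + 1))) := fcomp F _ _ _ _
    rw [h]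
    refine dtrans (F.contractive (q := NEHom.id) (d := NEHom.id) ?_ ?_) (dist_of_eq (fid F) _) <;>
      exact fun m hm => OFE.dist_mono (Nat.le_of_lt_succ hm) ih

theorem conn_self (n : ℕ) : conn F b n n = NEHom.id := by
  induction n with
  | zero => exact to_zero F _ _
  | succ n ih =>
    rw [conn_succ, ih]; exact fid F

theorem conn_both (n k : ℕ) : (down F b k).comp (conn F b n (k + 1)) = conn F b n k ∧
    (conn F b (k + 1) n).comp (up F b k) = conn F b k n := by
  induction n generalizing k with
  | zero =>
    refine ⟨?_, to_zero F _ _⟩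
    rw [conn_zero]
    change ((down F b k).comp (up F b k)).comp (conn F b 0 k) = _
    rw [down_up]; rfl
  | succ n ih =>
    cases k with
    | zero =>
      refine ⟨to_zero F _ _, ?_⟩
      clear ih
      induction n with
      | zero =>
        rw [conn_zero, conn_self, conn_self]; rfl
      | succ n ih =>
        rw [conn_zero, ← ih, conn_succ, conn_succ]
        change (F.map (conn F b (n + 1) 0) (conn F b 0 (n + 1))).comp (up F b 0) =
          ((F.map (down F b n) (up F b n)).comp (F.map (conn F b n 0) (conn F b 0 n))).comp (up F b 0)
        rw [fcomp, to_zero F (conn F b (n + 1) 0) ((conn F b n 0).comp (down F b n)), conn_zero]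
    | succ k =>
      constructor
      · rw [conn_succ, conn_succ]
        change (F.map (up F b k) (down F b k)).comp
          (F.map (conn F b (k + 1) n) (conn F b n (k + 1))) = F.map (conn F b k n) (conn F b n k)
        rw [fcomp, (ih k).1, (ih k).2]
      · rw [conn_succ, conn_succ]
        change (F.map (conn F b n (k + 1)) (conn F b (k + 1) n)).comp
          (F.map (down F b k) (up F b k)) = F.map (conn F b n k) (conn F b k n)
        rw [fcomp, (ih k).1, (ih k).2]

theorem conn_le (n k : ℕ) (h : n ≤ k) : conn F b n (k + 1) = (up F b k).comp (conn F b n k) ∧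
    conn F b (k + 1) n = (conn F b k n).comp (down F b k) := by
  induction n generalizing k with
  | zero => exact ⟨conn_zero F b k, to_zero F _ _⟩
  | succ n ih =>
    cases k with
    | zero => omega
    | succ k =>
      obtain ⟨h₁, h₂⟩ := ih k (by omega)
      constructor
      · rw [conn_succ, conn_succ]
        change F.map (conn F b (k + 1) n) (conn F b n (k + 1)) =
          (F.map (down F b k) (up F b k)).comp (F.map (conn F b k n) (conn F b n k))
        rw [fcomp, h₁, h₂]
      · rw [conn_succ, conn_succ]
        change F.map (conn F b n (k + 1)) (conn F b (k + 1) n) =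
          (F.map (conn F b n k) (conn F b k n)).comp (F.map (up F b k) (down F b k))
        rw [fcomp, h₁, h₂]

end Sol

/-- The guarded recursive type `X ≅ F X`: the limit of the tower of approximations. -/
structure Sol (F : GFunctor) (b : F.obj Unit) where
  app : (k : ℕ) → Sol.T F k
  coh : ∀ k, Sol.down F b k (app (k + 1)) = app k

namespace Sol

variable (F : GFunctor) (b : F.obj Unit)

theorem ext' {F : GFunctor} {b : F.obj Unit} {x y : Sol F b} (h : ∀ k, x.app k = y.app k) : x = y := by
  cases x; cases y; congr; exact funext h

instance : OFE (Sol F b) where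
  dist n x y := ∀ k, dist n (x.app k) (y.app k)
  dist_equiv n := ⟨fun x k => drefl n (x.app k), fun h k => dsymm (h k), fun h h' k => dtrans (h k) (h' k)⟩
  dist_mono hm h k := OFE.dist_mono hm (h k)
  eq_of_dist h := ext' fun k => OFE.eq_of_dist fun n => h n k

instance : COFE (Sol F b) where
  complete c hc := by
    have hx : ∀ k, IsChain fun n => (c n).app k := fun k n => hc n k
    refine ⟨⟨fun k => lim _ (hx k), fun k => OFE.eq_of_dist fun n => ?_⟩, fun n k => lim_spec _ (hx k) n⟩
    refine dtrans ((down F b k).ne (lim_spec _ (hx (k + 1)) n)) ?_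
    rw [(c n).coh k]
    exact dsymm (lim_spec _ (hx k) n)

def proj (k : ℕ) : Sol F b -n> T F k := ⟨fun x => x.app k, fun h => h k⟩

def emb (n : ℕ) : T F n -n> Sol F b :=
  ⟨fun x => ⟨fun k => conn F b n k x, fun k => congrArg (fun f => f.toFun x) (conn_both F b n k).1⟩,
    fun h k => (conn F b n k).ne h⟩

theorem proj_emb (n k : ℕ) : (proj F b k).comp (emb F b n) = conn F b n k := rfl

theorem conn_app (x : Sol F b) {n k : ℕ} (h : k ≤ n) : conn F b n k (x.app n) = x.app k := by
  induction n, h using Nat.le_induction with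
  | base => rw [conn_self]; rfl
  | succ n hn ih =>
    rw [(conn_le F b k n hn).2]
    exact (congrArg (conn F b n k) (x.coh n)).trans ih

theorem conn_app_dist (x : Sol F b) (n k : ℕ) : dist n (conn F b (n + 1) k (x.app (n + 1))) (x.app k) := by
  rcases le_total k (n + 1) with h | h
  · exact dist_of_eq (conn_app F b x h) n
  · induction k, h using Nat.le_induction with
    | base => exact dist_of_eq (conn_app F b x le_rfl) n
    | succ k hk ih =>
      rw [(conn_le F b (n + 1) k hk).1]
      refine dtrans ((up F b k).ne ih) ?_
      obtain ⟨j, rfl⟩ : ∃ j, k = j + 1 := ⟨k - 1, by omega⟩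
      rw [← x.coh (j + 1)]
      exact OFE.dist_mono (by omega) (up_down F b j (x.app (j + 2)))

theorem emb_proj (n : ℕ) : dist n ((emb F b (n + 1)).comp (proj F b (n + 1))) NEHom.id :=
  fun x k => conn_app_dist F b x n k

theorem emb_proj_later (n : ℕ) : DistLater n ((emb F b n).comp (proj F b n)) NEHom.id := by
  intro m hm
  obtain ⟨j, rfl⟩ : ∃ j, n = j + 1 := ⟨n - 1, by omega⟩
  exact OFE.dist_mono (by omega) (emb_proj F b j)

/-- The approximants of the unfolding map. -/
def unfoldApprox (n : ℕ) : Sol F b -n> F.obj (Sol F b) :=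
  (F.map (proj F b n) (emb F b n)).comp (proj F b (n + 1))

theorem unfoldChain : IsChain (unfoldApprox F b) := by
  intro n x
  have h : unfoldApprox F b n x =
      F.map ((up F b n).comp (proj F b n)) ((emb F b n).comp (down F b n)) (x.app (n + 2)) :=
    (congrArg (F.map (proj F b n) (emb F b n)) (x.coh (n + 1)).symm).trans
      (F.map_comp (up F b n) (down F b n) (proj F b n) (emb F b n) (x.app (n + 2))).symm
  rw [h]
  have h₁ : DistLater n (proj F b (n + 1)) ((up F b n).comp (proj F b n)) := by
    intro m hm y
    obtain ⟨j, rfl⟩ : ∃ j, n = j + 1 := ⟨n - 1, by omega⟩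
    refine OFE.dist_mono (by omega : m ≤ j) (dsymm (x := up F b (j + 1) (y.app (j + 1))) ?_)
    rw [← y.coh (j + 1)]
    exact up_down F b j (y.app (j + 2))
  have h₂ : DistLater n (emb F b (n + 1)) ((emb F b n).comp (down F b n)) := by
    intro m hm y k
    obtain ⟨j, rfl⟩ : ∃ j, n = j + 1 := ⟨n - 1, by omega⟩
    have h₂ : conn F b (j + 1) k (down F b (j + 1) y) =
        conn F b (j + 2) k (up F b (j + 1) (down F b (j + 1) y)) :=
      (congrArg (fun f => f.toFun (down F b (j + 1) y)) (conn_both F b k (j + 1)).2).symm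
    refine OFE.dist_mono (by omega : m ≤ j) (dsymm (dtrans (dist_of_eq h₂ j) ?_))
    exact (conn F b (j + 2) k).ne (up_down F b j y)
  exact F.contractive h₁ h₂ (x.app (n + 2))

/-- The unfolding isomorphism `X → F X`. -/
def unfold : Sol F b -n> F.obj (Sol F b) := lim _ (unfoldChain F b)

/-- The folding isomorphism `F X → X`. -/
def fold : F.obj (Sol F b) -n> Sol F b where
  toFun u :=
    { app := fun k => match k with
        | 0 => ()
        | k + 1 => F.map (emb F b k) (proj F b k) u
      coh := fun k => by
        cases k with
        | zero => rfl
        | succ k =>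
          change F.map (up F b k) (down F b k) (F.map (emb F b (k + 1)) (proj F b (k + 1)) u) = _
          rw [← F.map_comp]
          have h₁ : (emb F b (k + 1)).comp (up F b k) = emb F b k :=
            NEHom.ext fun y => ext' fun i => congrArg (fun f => f.toFun y) (conn_both F b i k).2
          have h₂ : (down F b k).comp (proj F b (k + 1)) = proj F b k :=
            NEHom.ext fun x => x.coh k
          rw [h₁, h₂] }
  ne h k := by
    cases k with
    | zero => trivial
    | succ k => exact (F.map (emb F b k) (proj F b k)).ne h

theorem unfold_fold (u : F.obj (Sol F b)) : unfold F b (fold F b u) = u := by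
  refine OFE.eq_of_dist fun n => dtrans (lim_spec _ (unfoldChain F b) n _) ?_
  change dist n (F.map (proj F b n) (emb F b n) (F.map (emb F b n) (proj F b n) u)) u
  rw [← F.map_comp]
  exact dtrans (F.contractive (emb_proj_later F b n) (emb_proj_later F b n) u)
    (dist_of_eq (F.map_id u) n)

theorem fold_unfold (x : Sol F b) : fold F b (unfold F b x) = x := by
  refine OFE.eq_of_dist fun n k => ?_
  cases k with
  | zero => trivial
  | succ k =>
    change dist n (F.map (emb F b k) (proj F b k) (unfold F b x)) (x.app (k + 1))
    have h := (F.map (emb F b k) (proj F b k)).ne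
      (OFE.dist_mono (le_max_left n k) (lim_spec _ (unfoldChain F b) (max n k) x))
    refine dtrans h (dist_of_eq ?_ n)
    refine (F.map_comp (proj F b (max n k)) (emb F b (max n k)) (emb F b k) (proj F b k)
      (x.app (max n k + 1))).symm.trans ?_
    rw [proj_emb, proj_emb, ← conn_succ]
    exact conn_app F b x (Nat.succ_le_succ (le_max_right n k))

end Sol

/-! ## Guarded interaction trees -/

/-- Effect signatures: names of operations, with input and output arities. -/
structure Signature where
  Op : Type
  Ins : Op → GFunctor
  Outs : Op → GFunctor

/-- Runtime errors, and other errors. -/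
inductive Error where
  | runTime
  | other (code : ℕ)

/-- The functor whose fixed point is the type of guarded interaction trees. -/
inductive ITF (E : Signature) (A X : Type) [COFE X] : Type where
  | ret (a : A)
  | fn (g : Later (X -n> X))
  | err (e : Error)
  | tau (t : Later X)
  | vis (i : E.Op) (x : (E.Ins i).obj X) (k : (E.Outs i).obj X -n> Later X)

namespace ITF

variable {E : Signature} {A X : Type} [COFE X]

/-- Equality at time `n`; the ground type is discrete. -/
inductive Dist (n : ℕ) : ITF E A X → ITF E A X → Prop where
  | ret (a : A) : Dist n (.ret a) (.ret a)
  | fn {g g' : Later (X -n> X)} : dist n g g' → Dist n (.fn g) (.fn g')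
  | err (e : Error) : Dist n (.err e) (.err e)
  | tau {t t' : Later X} : dist n t t' → Dist n (.tau t) (.tau t')
  | vis (i : E.Op) {x x' : (E.Ins i).obj X} {k k' : (E.Outs i).obj X -n> Later X} :
      dist n x x' → dist n k k' → Dist n (.vis i x k) (.vis i x' k')

instance : OFE (ITF E A X) where
  dist n := Dist n
  dist_equiv n := by
    refine ⟨fun u => ?_, fun {u v} h => ?_, fun {u v w} h h' => ?_⟩
    · cases u with
      | ret a => exact .ret a
      | fn g => exact .fn (drefl n g)
      | err e => exact .err e
      | tau t => exact .tau (drefl n t)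
      | vis i x k => exact .vis i (drefl n x) (drefl n k)
    · cases h with
      | ret a => exact .ret a
      | fn h => exact .fn (dsymm h)
      | err e => exact .err e
      | tau h => exact .tau (dsymm h)
      | vis i h₁ h₂ => exact .vis i (dsymm h₁) (dsymm h₂)
    · cases h with
      | ret a => exact h'
      | fn h => cases h' with | fn h' => exact .fn (dtrans h h')
      | err e => exact h'
      | tau h => cases h' with | tau h' => exact .tau (dtrans h h')
      | vis i h₁ h₂ => cases h' with | vis _ h₁' h₂' => exact .vis i (dtrans h₁ h₁') (dtrans h₂ h₂')
  dist_mono hm h := by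
    cases h with
    | ret a => exact .ret a
    | fn h => exact .fn (OFE.dist_mono hm h)
    | err e => exact .err e
    | tau h => exact .tau (OFE.dist_mono hm h)
    | vis i h₁ h₂ => exact .vis i (OFE.dist_mono hm h₁) (OFE.dist_mono hm h₂)
  eq_of_dist {u v} h := by
    cases h 0 with
    | ret a => rfl
    | fn _ => exact congrArg _ (OFE.eq_of_dist fun n => by cases h n with | fn h => exact h)
    | err e => rfl
    | tau _ => exact congrArg _ (OFE.eq_of_dist fun n => by cases h n with | tau h => exact h)
    | vis i _ _ =>
      exact congrArg₂ (ITF.vis i)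
        (OFE.eq_of_dist fun n => by cases h n with | vis _ h _ => exact h)
        (OFE.eq_of_dist fun n => by cases h n with | vis _ _ h => exact h)

instance : COFE (ITF E A X) where
  complete c hc := by
    have h0 : ∀ n, Dist 0 (c 0) (c n) := fun n => dsymm (IsChain.le hc (Nat.zero_le n))
    cases h : c 0 with
    | ret a =>
      refine ⟨.ret a, fun n => ?_⟩
      have := h0 n
      rw [h] at this
      generalize c n = u at *
      cases this
      exact .ret a
    | err e =>
      refine ⟨.err e, fun n => ?_⟩
      have := h0 n
      rw [h] at this
      generalize c n = u at *
      cases this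
      exact .err e
    | fn g =>
      have hex : ∀ n, ∃ g, c n = .fn g := fun n => by
        have := h0 n
        rw [h] at this
        generalize c n = u at *
        cases this
        exact ⟨_, rfl⟩
      choose d hd using hex
      obtain ⟨x, hx⟩ := COFE.complete d fun n => by
        have := hc n
        rw [hd, hd] at this
        cases this with | fn h => exact h
      exact ⟨.fn x, fun n => by rw [hd]; exact .fn (hx n)⟩
    | tau t =>
      have hex : ∀ n, ∃ t, c n = .tau t := fun n => by
        have := h0 n
        rw [h] at this
        generalize c n = u at *
        cases this
        exact ⟨_, rfl⟩
      choose d hd using hex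
      obtain ⟨x, hx⟩ := COFE.complete d fun n => by
        have := hc n
        rw [hd, hd] at this
        cases this with | tau h => exact h
      exact ⟨.tau x, fun n => by rw [hd]; exact .tau (hx n)⟩
    | vis i x k =>
      have hex : ∀ n, ∃ x k, c n = .vis i x k := fun n => by
        have := h0 n
        rw [h] at this
        generalize c n = u at *
        cases this
        exact ⟨_, _, rfl⟩
      choose d e hd using hex
      obtain ⟨x, hx⟩ := COFE.complete d fun n => by
        have := hc n
        rw [hd, hd] at this
        cases this with | vis _ h _ => exact h
      obtain ⟨y, hy⟩ := COFE.complete e fun n => by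
        have := hc n
        rw [hd, hd] at this
        cases this with | vis _ _ h => exact h
      exact ⟨.vis i x y, fun n => by rw [hd]; exact .vis i (hx n) (hy n)⟩

variable {Y : Type} [COFE Y]

def mapFun (p : Y -n> X) (e : X -n> Y) : ITF E A X → ITF E A Y
  | .ret a => .ret a
  | .fn g => .fn (GFunctor.laterEndo.map p e g)
  | .err e => .err e
  | .tau t => .tau (Later.map e t)
  | .vis i x k => .vis i ((E.Ins i).map p e x) ((GFunctor.hom (E.Outs i) GFunctor.later).map p e k)

end ITF

/-- The functor `X ↦ A + ▶ (X → X) + Error + ▶ X + ∑ i, Ins i X × (Outs i X → ▶ X)`. -/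
def itFunctor (E : Signature) (A : Type) : GFunctor where
  obj X _ := ITF E A X
  inst _ _ := inferInstance
  map p e := ⟨ITF.mapFun p e, fun h => by
    cases h with
    | ret a => exact .ret a
    | fn h => exact .fn ((GFunctor.laterEndo.map p e).ne h)
    | err e => exact .err e
    | tau h => exact .tau ((Later.map e).ne h)
    | vis i h₁ h₂ => exact .vis i (((E.Ins i).map p e).ne h₁) (((GFunctor.hom (E.Outs i) GFunctor.later).map p e).ne h₂)⟩
  map_id u := by
    cases u with
    | vis i x k =>
      exact congrArg₂ (ITF.vis i) ((E.Ins i).map_id x)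
        ((GFunctor.hom (E.Outs i) GFunctor.later).map_id k)
    | _ => rfl
  map_comp p e q d u := by
    cases u with
    | vis i x k =>
      exact congrArg₂ (ITF.vis i) ((E.Ins i).map_comp p e q d x)
        ((GFunctor.hom (E.Outs i) GFunctor.later).map_comp p e q d k)
    | _ => rfl
  contractive hp he u := by
    cases u with
    | ret a => exact .ret a
    | fn g => exact .fn (GFunctor.laterEndo.contractive hp he g)
    | err e => exact .err e
    | tau t => exact .tau (Later.map_contractive he t)
    | vis i x k =>
      exact .vis i ((E.Ins i).contractive hp he x)
        ((GFunctor.hom (E.Outs i) GFunctor.later).contractive hp he k)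

/-- The point at which the tower of approximations starts. -/
def itBase (E : Signature) (A : Type) : (itFunctor E A).obj Unit :=
  (ITF.err .runTime : ITF E A Unit)

/-- The type `IT_E(A)` of guarded interaction trees over the signature `E` with ground type `A`. -/
def IT (E : Signature) (A : Type) : Type := Sol (itFunctor E A) (itBase E A)

namespace IT

variable {E : Signature} {A : Type}

instance : COFE (IT E A) :=
  inferInstanceAs (COFE (Sol (itFunctor E A) (itBase E A)))

/-- The defining isomorphism of guarded interaction trees. -/
def unfold : IT E A -n> ITF E A (IT E A) := Sol.unfold (itFunctor E A) (itBase E A)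

/-- The inverse of the defining isomorphism. -/
def fold : ITF E A (IT E A) -n> IT E A := Sol.fold (itFunctor E A) (itBase E A)

theorem unfold_fold (u : ITF E A (IT E A)) : unfold (fold u) = u :=
  Sol.unfold_fold (itFunctor E A) (itBase E A) u

theorem fold_unfold (α : IT E A) : fold (unfold α) = α := Sol.fold_unfold (itFunctor E A) (itBase E A) α

def Ret (a : A) : IT E A := fold (.ret a)
def Fun (g : Later (IT E A -n> IT E A)) : IT E A := fold (.fn g)
def Err (e : Error) : IT E A := fold (.err e)
def Tau (t : Later (IT E A)) : IT E A := fold (.tau t)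
def Vis (i : E.Op) (x : (E.Ins i).obj (IT E A)) (k : (E.Outs i).obj (IT E A) -n> Later (IT E A)) :
    IT E A := fold (.vis i x k)
def Tick (α : IT E A) : IT E A := Tau (.next α)

instance : Inhabited (IT E A) := ⟨Err .runTime⟩

theorem Fun_ne {n : ℕ} {g g' : Later (IT E A -n> IT E A)} (h : dist n g g') :
    dist n (Fun g) (Fun g') := fold.ne (.fn h)
theorem Tau_ne {n : ℕ} {t t' : Later (IT E A)} (h : dist n t t') : dist n (Tau t) (Tau t') :=
  fold.ne (.tau h)
theorem Vis_ne {n : ℕ} (i : E.Op) {x x' : (E.Ins i).obj (IT E A)}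
    {k k' : (E.Outs i).obj (IT E A) -n> Later (IT E A)} (h : dist n x x') (h' : dist n k k') :
    dist n (Vis i x k) (Vis i x' k') := fold.ne (.vis i h h')

/-! ### Sequencing operations -/

/-- What to do with a value: a function on the ground type and one on function values. -/
abbrev Cases (E : Signature) (A : Type) : Type :=
  (A → IT E A) × (Later (IT E A -n> IT E A) -n> IT E A)

/-- One unfolding of `elim`. -/
def elimStep (S : Cases E A -n> IT E A -n> IT E A) (h : Cases E A) :
    ITF E A (IT E A) → IT E A
  | .ret a => h.1 a
  | .fn g => h.2 g
  | .err e => Err e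
  | .tau t => Tau (Later.map (S h) t)
  | .vis i x k => Vis i x ((Later.map (S h)).comp k)

theorem elimStep_ne {n : ℕ} {S S' : Cases E A -n> IT E A -n> IT E A} {h h' : Cases E A}
    {u u' : ITF E A (IT E A)} (hS : DistLater n S S') (hh : dist n h h') (hu : dist n u u') :
    dist n (elimStep S h u) (elimStep S' h' u') := by
  have hSh : DistLater n (S h) (S' h') := fun m hm =>
    NEHom.dist_app (hS m hm) (OFE.dist_mono hm.le hh)
  cases hu with
  | ret a => exact hh.1 a
  | fn hg => exact NEHom.dist_app hh.2 hg
  | err e => exact drefl n _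
  | tau ht => exact Tau_ne (NEHom.dist_app (Later.map_contractive hSh) ht)
  | vis i hx hk => exact Vis_ne i hx fun y => dtrans (Later.map_contractive hSh _) (NEHom.ne _ (hk y))

/-- The functional whose guarded fixed point is `elim`. -/
def elimFun (S : Cases E A -n> IT E A -n> IT E A) : Cases E A -n> IT E A -n> IT E A :=
  ⟨fun h => ⟨fun α => elimStep S h (unfold α),
      fun hα => elimStep_ne (fun m _ => drefl m S) (drefl _ h) (unfold.ne hα)⟩,
    fun hh α => elimStep_ne (fun m _ => drefl m S) hh (drefl _ (unfold α))⟩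

theorem elimFun_contractive : Contractive (elimFun (E := E) (A := A)) :=
  fun hS h α => elimStep_ne hS (drefl _ h) (drefl _ (unfold α))

/-- `elim h α` evaluates `α` to a value and continues with it as told by `h`:
`elim h (Ret a) = h.1 a`, `elim h (Fun g) = h.2 g`, `elim h (Err e) = Err e`,
`elim h (Tau t) = Tau (▶ (elim h) t)` and `elim h (Vis i x k) = Vis i x (▶ (elim h) ∘ k)`. -/
def elim : Cases E A -n> IT E A -n> IT E A := fixp elimFun elimFun_contractive

theorem elim_eq (h : Cases E A) (α : IT E A) : elim h α = elimStep elim h (unfold α) :=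
  congrArg (fun S : Cases E A -n> IT E A -n> IT E A => S h α) (fixp_eq elimFun elimFun_contractive)

/-- `getval α f` evaluates `α` to a value and passes the value to `f`. -/
def getval (α : IT E A) (f : IT E A -n> IT E A) : IT E A :=
  elim (fun a => f (Ret a), ⟨fun g => f (Fun g), fun h => f.ne (Fun_ne h)⟩) α

/-- `getret α f` evaluates `α` to a value of the ground type and passes it to `f`. -/
def getret (α : IT E A) (f : A → IT E A) : IT E A := elim (f, NEHom.const (Err .runTime)) α

/-- `getfun α f` evaluates `α` to a function value and passes it to `f`. -/
def getfun (α : IT E A) (f : Later (IT E A -n> IT E A) -n> IT E A) : IT E A :=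
  elim (fun _ => Err .runTime, f) α

theorem getval_ne {n : ℕ} {α α' : IT E A} {f f' : IT E A -n> IT E A} (hα : dist n α α')
    (hf : dist n f f') : dist n (getval α f) (getval α' f') :=
  NEHom.dist_app (elim.ne ⟨fun a => hf (Ret a), fun g => hf (Fun g)⟩) hα

theorem getret_ne {n : ℕ} {α α' : IT E A} {f f' : A → IT E A} (hα : dist n α α')
    (hf : dist n f f') : dist n (getret α f) (getret α' f') :=
  NEHom.dist_app (elim.ne ⟨hf, drefl n _⟩) hα

theorem getfun_ne {n : ℕ} {α α' : IT E A} {f f' : Later (IT E A -n> IT E A) -n> IT E A}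
    (hα : dist n α α') (hf : dist n f f') : dist n (getfun α f) (getfun α' f') :=
  NEHom.dist_app (elim.ne ⟨fun _ => drefl n _, hf⟩) hα

/-- Application of a function, at a later time, to an argument. -/
def laterApp (g : Later (IT E A -n> IT E A)) (β : IT E A) : Later (IT E A) := .next (g.val β)

theorem laterApp_ne {n : ℕ} {g g' : Later (IT E A -n> IT E A)} {β β' : IT E A} (hg : dist n g g')
    (hβ : dist n β β') : dist n (laterApp g β) (laterApp g' β') :=
  fun m hm => NEHom.dist_app (hg m hm) (OFE.dist_mono hm.le hβ)

/-- Call-by-value application: evaluates `β` to a value, then `α` to a function value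
`Fun (Next g)`, and continues with `Tick (g β)`. -/
def app (α β : IT E A) : IT E A :=
  getval β ⟨fun v => getfun α ⟨fun g => Tau (laterApp g v),
      fun h => Tau_ne (laterApp_ne h (drefl _ v))⟩,
    fun h => getfun_ne (drefl _ α) fun g => Tau_ne (laterApp_ne (drefl _ g) h)⟩

theorem app_ne {n : ℕ} {α α' β β' : IT E A} (hα : dist n α α') (hβ : dist n β β') :
    dist n (app α β) (app α' β') :=
  getval_ne hβ fun _ => getfun_ne hα (drefl n _)

/-- Binary operations on numbers: evaluates `β`, then `α`, to values, and applies `f` if both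
values are numbers. -/
def natop (f : ℕ → ℕ → ℕ) (α β : IT E ℕ) : IT E ℕ :=
  getval β ⟨fun w => getval α ⟨fun v => getret v fun l => getret w fun m => Ret (f l m),
      fun h => getret_ne h (drefl _ _)⟩,
    fun h => getval_ne (drefl _ α) fun v => getret_ne (drefl _ v) fun _ => getret_ne h (drefl _ _)⟩

theorem natop_ne {n : ℕ} (f : ℕ → ℕ → ℕ) {α α' β β' : IT E ℕ} (hα : dist n α α')
    (hβ : dist n β β') : dist n (natop f α β) (natop f α' β') :=
  getval_ne hβ fun _ => getval_ne hα (drefl n _)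

/-- The conditional; a nonzero number counts as true. -/
def ifte (α β γ : IT E ℕ) : IT E ℕ := getret α fun n => if n = 0 then γ else β

theorem ifte_ne {n : ℕ} {α α' β β' γ γ' : IT E ℕ} (hα : dist n α α') (hβ : dist n β β')
    (hγ : dist n γ γ') : dist n (ifte α β γ) (ifte α' β' γ') :=
  getret_ne hα fun m => by
    by_cases h : m = 0
    · simpa [h] using hγ
    · simpa [h] using hβ

end IT

/-! ### Context-dependent reification -/

/-- Context-dependent reifiers: a type of states, and a function that takes the input of an
effect, the current state and the current continuation. -/
structure Reifier (E : Signature) (A : Type) where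
  State : Type
  inst : OFE State
  r : (i : E.Op) → ((E.Ins i).obj (IT E A) × State × ((E.Outs i).obj (IT E A) -n> Later (IT E A)))
    -n> Option (Later (IT E A) × State)

/-- Reification of the effect at the root of a tree. -/
def reify {E : Signature} {A : Type} (R : Reifier E A) (α : IT E A) (σ : R.State) :
    IT E A × R.State :=
  match IT.unfold α with
  | .vis i x κ =>
    match R.r i (x, σ, κ) with
    | some (β, σ') => (IT.Tau β, σ')
    | none => (IT.Err .runTime, σ)
  | _ => (IT.Err .runTime, σ)

/-- The reduction relation of guarded interaction trees. -/
inductive IStep {E : Signature} {A : Type} (R : Reifier E A) :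
    IT E A × R.State → IT E A × R.State → Prop where
  | tick {α β : IT E A} {σ σ' : R.State} : α = IT.Tick β → σ = σ' → IStep R (α, σ) (β, σ')
  | reify {α β : IT E A} {σ σ' : R.State} (i : E.Op) (x : (E.Ins i).obj (IT E A))
      (k : (E.Outs i).obj (IT E A) -n> Later (IT E A)) :
      α = IT.Vis i x k → reify R α σ = (IT.Tick β, σ') → IStep R (α, σ) (β, σ')

end GITree

namespace Delim

open GITree GITree.IT
open GITree.OFE (dist)

/-! ## Syntax of the language with shift and reset

Variables are de Bruijn indices. -/

mutual
/-- Expressions. In `shift e` the index `0` of `e` is the captured continuation. -/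
inductive Expr : Type where
  | val (v : Val)
  | var (x : ℕ)
  | app (e₁ e₂ : Expr)
  | natop (op : ℕ → ℕ → ℕ) (e₁ e₂ : Expr)
  | ite (e e₁ e₂ : Expr)
  | shift (e : Expr)
  | reset (e : Expr)
  /-- `e₁ @ e₂`, application of a continuation. -/
  | kapp (e₁ e₂ : Expr)

/-- Values. In `fix e`, the recursive function `rec f x = e`, the index `0` of `e` is the argument
`x` and the index `1` is the function `f` itself. -/
inductive Val : Type where
  | nat (n : ℕ)
  | fix (e : Expr)
  | cont (K : Ectx)

/-- Evaluation contexts; the last frame is the innermost one. -/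
inductive Ectx : Type where
  | nil
  /-- `K[if □ then e₁ else e₂]` -/
  | ite (K : Ectx) (e₁ e₂ : Expr)
  /-- `K[v □]` -/
  | appR (K : Ectx) (v : Val)
  /-- `K[□ e]` -/
  | appL (K : Ectx) (e : Expr)
  /-- `K[op e □]` -/
  | natopR (K : Ectx) (op : ℕ → ℕ → ℕ) (e : Expr)
  /-- `K[op □ v]` -/
  | natopL (K : Ectx) (op : ℕ → ℕ → ℕ) (v : Val)
  /-- `K[□ @ v]` -/
  | kappL (K : Ectx) (v : Val)
  /-- `K[e @ □]` -/
  | kappR (K : Ectx) (e : Expr)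
end

/-- `K[e]`. -/
def plug : Ectx → Expr → Expr
  | .nil, e => e
  | .ite K e₁ e₂, e => plug K (.ite e e₁ e₂)
  | .appR K v, e => plug K (.app (.val v) e)
  | .appL K e', e => plug K (.app e e')
  | .natopR K op e', e => plug K (.natop op e' e)
  | .natopL K op v, e => plug K (.natop op e (.val v))
  | .kappL K v, e => plug K (.kapp e (.val v))
  | .kappR K e', e => plug K (.kapp e' e)

/-! ### Substitution -/

/-- The renaming under a binder. -/
def liftRen (r : ℕ → ℕ) : ℕ → ℕ
  | 0 => 0
  | x + 1 => r x + 1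

mutual
def renE : Expr → (ℕ → ℕ) → Expr
  | .val v, r => .val (renV v r)
  | .var x, r => .var (r x)
  | .app e₁ e₂, r => .app (renE e₁ r) (renE e₂ r)
  | .natop op e₁ e₂, r => .natop op (renE e₁ r) (renE e₂ r)
  | .ite e e₁ e₂, r => .ite (renE e r) (renE e₁ r) (renE e₂ r)
  | .shift e, r => .shift (renE e (liftRen r))
  | .reset e, r => .reset (renE e r)
  | .kapp e₁ e₂, r => .kapp (renE e₁ r) (renE e₂ r)

def renV : Val → (ℕ → ℕ) → Val
  | .nat n, _ => .nat n
  | .fix e, r => .fix (renE e (liftRen (liftRen r)))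
  | .cont K, r => .cont (renK K r)

def renK : Ectx → (ℕ → ℕ) → Ectx
  | .nil, _ => .nil
  | .ite K e₁ e₂, r => .ite (renK K r) (renE e₁ r) (renE e₂ r)
  | .appR K v, r => .appR (renK K r) (renV v r)
  | .appL K e, r => .appL (renK K r) (renE e r)
  | .natopR K op e, r => .natopR (renK K r) op (renE e r)
  | .natopL K op v, r => .natopL (renK K r) op (renV v r)
  | .kappL K v, r => .kappL (renK K r) (renV v r)
  | .kappR K e, r => .kappR (renK K r) (renE e r)
end

/-- The substitution under a binder. -/
def liftSub (s : ℕ → Expr) : ℕ → Expr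
  | 0 => .var 0
  | x + 1 => renE (s x) Nat.succ

mutual
/-- Simultaneous capture-avoiding substitution. -/
def subE : Expr → (ℕ → Expr) → Expr
  | .val v, s => .val (subV v s)
  | .var x, s => s x
  | .app e₁ e₂, s => .app (subE e₁ s) (subE e₂ s)
  | .natop op e₁ e₂, s => .natop op (subE e₁ s) (subE e₂ s)
  | .ite e e₁ e₂, s => .ite (subE e s) (subE e₁ s) (subE e₂ s)
  | .shift e, s => .shift (subE e (liftSub s))
  | .reset e, s => .reset (subE e s)
  | .kapp e₁ e₂, s => .kapp (subE e₁ s) (subE e₂ s)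

def subV : Val → (ℕ → Expr) → Val
  | .nat n, _ => .nat n
  | .fix e, s => .fix (subE e (liftSub (liftSub s)))
  | .cont K, s => .cont (subK K s)

def subK : Ectx → (ℕ → Expr) → Ectx
  | .nil, _ => .nil
  | .ite K e₁ e₂, s => .ite (subK K s) (subE e₁ s) (subE e₂ s)
  | .appR K v, s => .appR (subK K s) (subV v s)
  | .appL K e, s => .appL (subK K s) (subE e s)
  | .natopR K op e, s => .natopR (subK K s) op (subE e s)
  | .natopL K op v, s => .natopL (subK K s) op (subV v s)
  | .kappL K v, s => .kappL (subK K s) (subV v s)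
  | .kappR K e, s => .kappR (subK K s) (subE e s)
end

/-- The substitution of `v` for the index `0`. -/
def inst (v : Val) : ℕ → Expr
  | 0 => .val v
  | x + 1 => .var x

/-- The substitution of `v` for the index `0` and `w` for the index `1`. -/
def inst₂ (v w : Val) : ℕ → Expr
  | 0 => .val v
  | 1 => .val w
  | x + 2 => .var x

/-! ### The abstract machine -/

/-- Metacontinuations. -/
abbrev Mcont : Type := List Ectx

/-- Configurations. -/
inductive Config : Type where
  | eval (e : Expr) (K : Ectx) (mk : Mcont)
  | cont (K : Ectx) (v : Val) (mk : Mcont)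
  | mcont (mk : Mcont) (v : Val)
  | term (e : Expr)
  | ret (v : Val)

/-- One step of the abstract machine. -/
inductive Step : Config → Config → Prop where
  | term (e : Expr) : Step (.term e) (.eval e .nil [])
  | mcont_cons (K : Ectx) (mk : Mcont) (v : Val) : Step (.mcont (K :: mk) v) (.cont K v mk)
  | mcont_nil (v : Val) : Step (.mcont [] v) (.ret v)
  | cont_nil (v : Val) (mk : Mcont) : Step (.cont .nil v mk) (.mcont mk v)
  | cont_kappL (K K' : Ectx) (v : Val) (mk : Mcont) :
      Step (.cont (.kappL K v) (.cont K') mk) (.cont K' v (K :: mk))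
  | cont_kappR (K : Ectx) (e : Expr) (v : Val) (mk : Mcont) :
      Step (.cont (.kappR K e) v mk) (.eval e (.kappL K v) mk)
  | cont_appL (K : Ectx) (e : Expr) (v : Val) (mk : Mcont) :
      Step (.cont (.appL K e) v mk) (.eval e (.appR K v) mk)
  | cont_appR (K : Ectx) (e : Expr) (v : Val) (mk : Mcont) :
      Step (.cont (.appR K (.fix e)) v mk) (.eval (subE e (inst₂ v (.fix e))) K mk)
  | cont_natopR (K : Ectx) (op : ℕ → ℕ → ℕ) (e : Expr) (v : Val) (mk : Mcont) :
      Step (.cont (.natopR K op e) v mk) (.eval e (.natopL K op v) mk)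
  | cont_natopL (K : Ectx) (op : ℕ → ℕ → ℕ) (m n : ℕ) (mk : Mcont) :
      Step (.cont (.natopL K op (.nat n)) (.nat m) mk) (.eval (.val (.nat (op m n))) K mk)
  | cont_ite_zero (K : Ectx) (e₁ e₂ : Expr) (mk : Mcont) :
      Step (.cont (.ite K e₁ e₂) (.nat 0) mk) (.eval e₂ K mk)
  | cont_ite_succ (K : Ectx) (e₁ e₂ : Expr) (n : ℕ) (mk : Mcont) :
      Step (.cont (.ite K e₁ e₂) (.nat (n + 1)) mk) (.eval e₁ K mk)
  | eval_val (v : Val) (K : Ectx) (mk : Mcont) : Step (.eval (.val v) K mk) (.cont K v mk)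
  | eval_kapp (e₀ e₁ : Expr) (K : Ectx) (mk : Mcont) :
      Step (.eval (.kapp e₀ e₁) K mk) (.eval e₁ (.kappR K e₀) mk)
  | eval_app (e₀ e₁ : Expr) (K : Ectx) (mk : Mcont) :
      Step (.eval (.app e₀ e₁) K mk) (.eval e₀ (.appL K e₁) mk)
  | eval_natop (op : ℕ → ℕ → ℕ) (e₀ e₁ : Expr) (K : Ectx) (mk : Mcont) :
      Step (.eval (.natop op e₀ e₁) K mk) (.eval e₁ (.natopR K op e₀) mk)
  | eval_ite (e e₁ e₂ : Expr) (K : Ectx) (mk : Mcont) :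
      Step (.eval (.ite e e₁ e₂) K mk) (.eval e (.ite K e₁ e₂) mk)
  | eval_reset (e : Expr) (K : Ectx) (mk : Mcont) :
      Step (.eval (.reset e) K mk) (.eval e .nil (K :: mk))
  | eval_shift (e : Expr) (K : Ectx) (mk : Mcont) :
      Step (.eval (.shift e) K mk) (.eval (subE e (inst (.cont K))) .nil mk)

/-! ## Effects for delimited control -/

inductive Op : Type where
  | reset | shift | pop | appcont

/-- The input arities. -/
abbrev Ins : Op → GFunctor
  | .reset => .later
  | .shift => .hom (.hom .later .later) .later
  | .pop => .later
  | .appcont => .prod .later .laterEndo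

/-- The output arities. -/
abbrev Outs : Op → GFunctor
  | .reset => .later
  | .shift => .later
  | .pop => .const Empty
  | .appcont => .later

abbrev sig : Signature := ⟨Op, Ins, Outs⟩

/-- Interaction trees for delimited control, with natural numbers as ground type. -/
abbrev DIT : Type := IT sig ℕ

/-- Semantic continuations. -/
abbrev SCont : Type := Later DIT -n> Later DIT

/-- The state is a stack of continuations. -/
abbrev State : Type := List SCont

def rReset : (Later DIT × State × SCont) -n> Option (Later DIT × State) where
  toFun u := some (u.1, u.2.2 :: u.2.1)
  ne h := .some ⟨h.1, .cons h.2.2 h.2.1⟩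

def rShift : ((SCont -n> Later DIT) × State × SCont) -n> Option (Later DIT × State) where
  toFun u := some (u.1 u.2.2, u.2.1)
  ne h := .some ⟨NEHom.dist_app h.1 h.2.2, h.2.1⟩

def rPop : (Later DIT × State × (Empty -n> Later DIT)) -n> Option (Later DIT × State) where
  toFun u := match u.2.1 with
    | [] => some (u.1, [])
    | κ :: σ => some (κ u.1, σ)
  ne := by
    rintro n ⟨e, σ, k⟩ ⟨e', σ', k'⟩ ⟨h₁, h₂, -⟩
    change List.Forall₂ _ σ σ' at h₂
    cases h₂ with
    | nil => exact .some ⟨h₁, .nil⟩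
    | cons hκ hσ => exact .some ⟨NEHom.dist_app hκ h₁, hσ⟩

def rAppcont : ((Later DIT × Later (DIT -n> DIT)) × State × SCont) -n>
    Option (Later DIT × State) where
  toFun u := some (.next (u.1.2.val u.1.1.val), u.2.2 :: u.2.1)
  ne h := .some ⟨fun m hm => NEHom.dist_app (h.1.2 m hm) (h.1.1 m hm), .cons h.2.2 h.2.1⟩

/-- The context-dependent reifier for delimited control. -/
def reifier : Reifier sig ℕ where
  State := State
  inst := inferInstance
  r
    | .reset => rReset
    | .shift => rShift
    | .pop => rPop
    | .appcont => rAppcont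

def RESET (e : Later DIT) : DIT := Vis (E := sig) Op.reset e NEHom.id

def SHIFT (f : SCont -n> Later DIT) : DIT := Vis (E := sig) Op.shift f NEHom.id

def POP (e : Later DIT) : DIT := Vis (E := sig) Op.pop e ⟨fun x : Empty => x.elim, fun {_ x} => x.elim⟩

def APPCONT (e : Later DIT) (f : Later (DIT -n> DIT)) : DIT :=
  Vis (E := sig) Op.appcont (e, f) NEHom.id

theorem next_ne {α : Type} [OFE α] {n : ℕ} {x y : α} (h : dist n x y) :
    dist n (Later.next x) (Later.next y) := fun _ hm => OFE.dist_mono hm.le h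

/-- `popAux β` evaluates `β` to a value and then pops a continuation off the stack. -/
def popAux : DIT -n> DIT where
  toFun β := getval β ⟨fun v => POP (.next v), fun h => Vis_ne (E := sig) Op.pop (next_ne h) (drefl _ _)⟩
  ne h := getval_ne h (drefl _ _)

/-! ## Denotational semantics -/

/-- Environments. -/
abbrev Env : Type := ℕ → DIT

/-- Extension of an environment at index `0`. -/
def ext (ρ : Env) (α : DIT) : Env
  | 0 => α
  | x + 1 => ρ x

theorem ext_ne {n : ℕ} {ρ ρ' : Env} {α α' : DIT} (hρ : dist n ρ ρ') (hα : dist n α α') :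
    dist n (ext ρ α) (ext ρ' α') := by
  intro x
  cases x with
  | zero => exact hα
  | succ x => exact hρ x

/-- The meaning of application: evaluates `α`, then `β`, and applies the values. -/
def appSem (α β : DIT) : DIT :=
  getval α ⟨fun f => getval β ⟨fun x => app f x, fun h => app_ne (drefl _ f) h⟩,
    fun h => getval_ne (drefl _ β) fun x => app_ne h (drefl _ x)⟩

theorem appSem_ne {n : ℕ} {α α' β β' : DIT} (hα : dist n α α') (hβ : dist n β β') :
    dist n (appSem α β) (appSem α' β') := getval_ne hα fun _ => getval_ne hβ (drefl n _)

/-- The meaning of application of a continuation: evaluates `β`, then `α`. -/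
def kappSem (α β : DIT) : DIT :=
  getval β ⟨fun x => getfun α ⟨fun y => APPCONT (.next x) y,
      fun h => Vis_ne (E := sig) Op.appcont ⟨drefl _ (Later.next x), h⟩ (drefl _ _)⟩,
    fun h => getfun_ne (drefl _ α) fun y =>
      Vis_ne (E := sig) Op.appcont ⟨next_ne h, drefl _ y⟩ (drefl _ _)⟩

theorem kappSem_ne {n : ℕ} {α α' β β' : DIT} (hα : dist n α α') (hβ : dist n β β') :
    dist n (kappSem α β) (kappSem α' β') := getval_ne hβ fun _ => getfun_ne hα (drefl n _)

/-- `RESET (popAux α)`. -/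
def resetSem (α : DIT) : DIT := RESET (.next (popAux α))

theorem resetSem_ne {n : ℕ} {α α' : DIT} (h : dist n α α') : dist n (resetSem α) (resetSem α') :=
  Vis_ne (E := sig) Op.reset (next_ne (popAux.ne h)) (drefl _ _)

/-- `Fun (Next (λ y, Tau (κ (Next y))))`. -/
def contFun (κ : SCont) : DIT :=
  Fun (.next ⟨fun y => Tau (κ (.next y)), fun h => Tau_ne (κ.ne (next_ne h))⟩)

theorem contFun_ne {n : ℕ} {κ κ' : SCont} (h : dist n κ κ') : dist n (contFun κ) (contFun κ') :=
  Fun_ne (next_ne fun y => Tau_ne (h (.next y)))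

/-- `SHIFT (λ κ, popAux (d (ρ, Fun (Next (λ y, Tau (κ (Next y)))))))`. -/
def shiftSem (d : Env -n> DIT) (ρ : Env) : DIT :=
  SHIFT ⟨fun κ => .next (popAux (d (ext ρ (contFun κ)))),
    fun h => next_ne (popAux.ne (d.ne (ext_ne (drefl _ ρ) (contFun_ne h))))⟩

theorem shiftSem_ne {n : ℕ} (d : Env -n> DIT) {ρ ρ' : Env} (h : dist n ρ ρ') :
    dist n (shiftSem d ρ) (shiftSem d ρ') :=
  Vis_ne (E := sig) Op.shift
    (fun κ => next_ne (popAux.ne (d.ne (ext_ne h (drefl _ (contFun κ)))))) (drefl _ _)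

/-- One unfolding of a recursive function with body `d`:
`λ ρ, Fun (Next (λ v, d (ρ, φ ρ, v)))`. -/
def fixStep (d : Env -n> DIT) (φ : Env -n> DIT) : Env -n> DIT where
  toFun ρ := Fun (.next ⟨fun v => d (ext (ext ρ (φ ρ)) v), fun h => d.ne (ext_ne (drefl _ _) h)⟩)
  ne h := Fun_ne (next_ne fun v => d.ne (ext_ne (ext_ne h (φ.ne h)) (drefl _ v)))

theorem fixStep_contractive (d : Env -n> DIT) : Contractive (fixStep d) :=
  fun hφ ρ => Fun_ne fun m hm v => d.ne (ext_ne (ext_ne (drefl m ρ) (hφ m hm ρ)) (drefl m v))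

/-- `Fun (Next (λ x, Tick (popAux (κ x))))`. -/
def contSem (κ : DIT -n> DIT) : DIT :=
  Fun (.next ⟨fun x => Tick (popAux (κ x)), fun h => Tau_ne (next_ne (popAux.ne (κ.ne h)))⟩)

theorem contSem_ne {n : ℕ} {κ κ' : DIT -n> DIT} (h : dist n κ κ') :
    dist n (contSem κ) (contSem κ') :=
  Fun_ne (next_ne fun x => Tau_ne (next_ne (popAux.ne (h x))))

/-- The context `λ x, k (s x)` formed by a context `k` and a frame `s`. -/
def frame (k : Env -n> DIT -n> DIT) (s : Env → DIT → DIT)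
    (hs : ∀ {n : ℕ} {ρ ρ' : Env} {x x' : DIT}, dist n ρ ρ' → dist n x x' →
      dist n (s ρ x) (s ρ' x')) : Env -n> DIT -n> DIT where
  toFun ρ := ⟨fun x => k ρ (s ρ x), fun h => (k ρ).ne (hs (drefl _ ρ) h)⟩
  ne h x := dtrans (k.ne h _) (NEHom.ne _ (hs h (drefl _ x)))

mutual
/-- The denotation of expressions. -/
def denE : Expr → (Env -n> DIT)
  | .val v => denV v
  | .var x => ⟨fun ρ => ρ x, fun h => h x⟩
  | .app e₁ e₂ => ⟨fun ρ => appSem (denE e₁ ρ) (denE e₂ ρ),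
      fun h => appSem_ne ((denE e₁).ne h) ((denE e₂).ne h)⟩
  | .natop op e₁ e₂ => ⟨fun ρ => natop op (denE e₁ ρ) (denE e₂ ρ),
      fun h => natop_ne op ((denE e₁).ne h) ((denE e₂).ne h)⟩
  | .ite e e₁ e₂ => ⟨fun ρ => ifte (denE e ρ) (denE e₁ ρ) (denE e₂ ρ),
      fun h => ifte_ne ((denE e).ne h) ((denE e₁).ne h) ((denE e₂).ne h)⟩
  | .shift e => ⟨fun ρ => shiftSem (denE e) ρ, fun h => shiftSem_ne (denE e) h⟩
  | .reset e => ⟨fun ρ => resetSem (denE e ρ), fun h => resetSem_ne ((denE e).ne h)⟩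
  | .kapp e₁ e₂ => ⟨fun ρ => kappSem (denE e₁ ρ) (denE e₂ ρ),
      fun h => kappSem_ne ((denE e₁).ne h) ((denE e₂).ne h)⟩

/-- The denotation of values. -/
def denV : Val → (Env -n> DIT)
  | .nat n => NEHom.const (Ret n)
  | .fix e => fixp (fixStep (denE e)) (fixStep_contractive (denE e))
  | .cont K => ⟨fun ρ => contSem (denK K ρ), fun h => contSem_ne ((denK K).ne h)⟩

/-- The denotation of evaluation contexts. -/
def denK : Ectx → (Env -n> DIT -n> DIT)
  | .nil => NEHom.const NEHom.id
  | .ite K e₁ e₂ => frame (denK K) (fun ρ x => ifte x (denE e₁ ρ) (denE e₂ ρ))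
      fun h hx => ifte_ne hx ((denE e₁).ne h) ((denE e₂).ne h)
  | .appR K v => frame (denK K) (fun ρ x => appSem (denV v ρ) x)
      fun h hx => appSem_ne ((denV v).ne h) hx
  | .appL K e => frame (denK K) (fun ρ x => appSem x (denE e ρ))
      fun h hx => appSem_ne hx ((denE e).ne h)
  | .natopR K op e => frame (denK K) (fun ρ x => natop op (denE e ρ) x)
      fun h hx => natop_ne op ((denE e).ne h) hx
  | .natopL K op v => frame (denK K) (fun ρ x => natop op x (denV v ρ))
      fun h hx => natop_ne op hx ((denV v).ne h)
  | .kappL K v => frame (denK K) (fun ρ x => kappSem x (denV v ρ))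
      fun h hx => kappSem_ne hx ((denV v).ne h)
  | .kappR K e => frame (denK K) (fun ρ x => kappSem (denE e ρ) x)
      fun h hx => kappSem_ne ((denE e).ne h) hx
end

/-- The denotation of metacontinuations. -/
def denM (mk : Mcont) (ρ : Env) : State := mk.map fun K => Later.map (popAux.comp (denK K ρ))

/-- The denotation of configurations. -/
def denC : Config → Env → DIT × State
  | .eval e K mk, ρ => (popAux (denE (plug K e) ρ), denM mk ρ)
  | .cont K v mk, ρ => (popAux (denE (plug K (.val v)) ρ), denM mk ρ)
  | .mcont mk v, ρ => (popAux (denV v ρ), denM mk ρ)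
  | .term e, ρ => (popAux (denE e ρ), [])
  | .ret v, ρ => (denV v ρ, [])

end Delim

end

namespace GITree.IT

variable {E : Signature} {A : Type}

/-! ### Computation rules for the sequencing operations -/

theorem elim_Ret (h : Cases E A) (a : A) : elim h (Ret a) = h.1 a := by
  rw [elim_eq, Ret, unfold_fold]; rfl

theorem elim_Fun (h : Cases E A) (g : Later (IT E A -n> IT E A)) : elim h (Fun g) = h.2 g := by
  rw [elim_eq, Fun, unfold_fold]; rfl

theorem elim_Tau (h : Cases E A) (t : Later (IT E A)) :
    elim h (Tau t) = Tau (Later.map (elim h) t) := by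
  rw [elim_eq, Tau, unfold_fold]; rfl

theorem elim_Vis (h : Cases E A) (i : E.Op) (x : (E.Ins i).obj (IT E A))
    (k : (E.Outs i).obj (IT E A) -n> Later (IT E A)) :
    elim h (Vis i x k) = Vis i x ((Later.map (elim h)).comp k) := by
  rw [elim_eq, Vis, unfold_fold]; rfl

/-- The trees of the form `Ret a` or `Fun g`. -/
inductive IsValue : IT E A → Prop where
  | ret (a : A) : IsValue (Ret a)
  | fn (g : Later (IT E A -n> IT E A)) : IsValue (Fun g)

theorem getval_of_isValue {α : IT E A} (hα : IsValue α) (f : IT E A -n> IT E A) :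
    getval α f = f α := by
  cases hα with
  | ret a => exact elim_Ret _ a
  | fn g => exact elim_Fun _ g

theorem getret_Ret (a : A) (f : A → IT E A) : getret (Ret a) f = f a := elim_Ret _ a

theorem getfun_Fun (g : Later (IT E A -n> IT E A)) (f : Later (IT E A -n> IT E A) -n> IT E A) :
    getfun (Fun g) f = f g := elim_Fun _ g

/-- Homomorphisms of interaction trees: maps that commute with `Tau` and `Vis`. -/
structure IsHom (f : IT E A -n> IT E A) : Prop where
  tau : ∀ t, f (Tau t) = Tau (Later.map f t)
  vis : ∀ i x k, f (Vis i x k) = Vis i x ((Later.map f).comp k)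

theorem IsHom.tick {f : IT E A -n> IT E A} (hf : IsHom f) (α : IT E A) :
    f (Tick α) = Tick (f α) := hf.tau _

theorem isHom_id : IsHom (NEHom.id : IT E A -n> IT E A) := ⟨fun _ => rfl, fun _ _ _ => rfl⟩

theorem isHom_elim (h : Cases E A) : IsHom (elim h) := ⟨elim_Tau h, elim_Vis h⟩

theorem IsHom.comp {g f : IT E A -n> IT E A} (hg : IsHom g) (hf : IsHom f) :
    IsHom (g.comp f) where
  tau t := (congrArg g (hf.tau t)).trans (hg.tau _)
  vis i x k := (congrArg g (hf.vis i x k)).trans (hg.vis i x _)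

/-- A homomorphism after a map that is given by elimination. -/
theorem IsHom.of_elim {g f : IT E A -n> IT E A} (hg : IsHom g) (h : Cases E A)
    (hf : ∀ α, f α = g (elim h α)) : IsHom f :=
  (NEHom.ext hf : f = g.comp (elim h)) ▸ hg.comp (isHom_elim h)

end GITree.IT

namespace GITree

theorem reify_Vis {E : Signature} {A : Type} (R : Reifier E A) (i : E.Op)
    (x : (E.Ins i).obj (IT E A)) (k : (E.Outs i).obj (IT E A) -n> Later (IT E A)) (σ σ' : R.State)
    (β : IT E A) (h : R.r i (x, σ, k) = some (.next β, σ')) :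
    reify R (IT.Vis i x k) σ = (IT.Tick β, σ') := by
  unfold reify
  rw [IT.Vis, IT.unfold_fold]
  dsimp only
  rw [h]
  rfl

theorem IStep.vis {E : Signature} {A : Type} {R : Reifier E A} {i : E.Op}
    {x : (E.Ins i).obj (IT E A)} {k : (E.Outs i).obj (IT E A) -n> Later (IT E A)} {σ σ' : R.State}
    {β : IT E A} (h : R.r i (x, σ, k) = some (.next β, σ')) :
    IStep R (IT.Vis i x k, σ) (β, σ') :=
  .reify i x k rfl (reify_Vis R i x k σ σ' β h)

end GITree

namespace Delim

open GITree GITree.IT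

theorem denV_fix_eq (e : Expr) (ρ : Env) : denV (.fix e) ρ =
    Fun (.next ⟨fun v => denE e (ext (ext ρ (denV (.fix e) ρ)) v),
      fun h => (denE e).ne (ext_ne (drefl _ _) h)⟩) := by
  have h : denV (.fix e) = fixStep (denE e) (denV (.fix e)) := by
    rw [denV]; exact fixp_eq _ (fixStep_contractive (denE e))
  exact congrArg (fun φ : Env -n> DIT => φ ρ) h

theorem isValue_denV (ρ : Env) : ∀ v : Val, IsValue (denV v ρ)
  | .nat n => by rw [denV]; exact .ret n
  | .fix e => denV_fix_eq e ρ ▸ .fn _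
  | .cont K => by rw [denV]; exact .fn _

theorem isHom_popAux : IsHom popAux := isHom_id.of_elim _ fun _ => rfl

theorem popAux_of_isValue {α : DIT} (hα : IsValue α) : popAux α = POP (.next α) :=
  getval_of_isValue hα _

/-! ### Frames -/

theorem kappSem_of_isValue (α : DIT) {β : DIT} (hβ : IsValue β) :
    kappSem α β = getfun α ⟨fun y => APPCONT (.next β) y,
      fun h => Vis_ne (E := sig) Op.appcont ⟨drefl _ (Later.next β), h⟩ (drefl _ _)⟩ :=
  getval_of_isValue hβ _

theorem appSem_of_isValue {α : DIT} (hα : IsValue α) (β : DIT) :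
    appSem α β = getval β ⟨fun x => app α x, fun h => app_ne (drefl _ α) h⟩ :=
  getval_of_isValue hα _

theorem appSem_Fun (g : Later (DIT -n> DIT)) {β : DIT} (hβ : IsValue β) :
    appSem (Fun g) β = Tau (laterApp g β) := by
  rw [appSem_of_isValue (.fn g), getval_of_isValue hβ]
  exact (getval_of_isValue hβ _).trans (getfun_Fun _ _)

theorem natop_of_isValue (op : ℕ → ℕ → ℕ) (α : DIT) {β : DIT} (hβ : IsValue β) :
    natop op α β = getval α ⟨fun v => getret v fun l => getret β fun m => Ret (op l m),
      fun h => getret_ne h (drefl _ _)⟩ :=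
  getval_of_isValue hβ _

theorem natop_Ret (op : ℕ → ℕ → ℕ) (m n : ℕ) : natop op (Ret m : DIT) (Ret n) = Ret (op m n) := by
  rw [natop_of_isValue op _ (.ret n), getval_of_isValue (.ret m)]
  exact (getret_Ret m _).trans (getret_Ret n _)

theorem ifte_Ret (n : ℕ) (α β : DIT) : ifte (Ret n) α β = if n = 0 then β else α := getret_Ret n _

theorem isHom_denK (ρ : Env) : ∀ K : Ectx, IsHom (denK K ρ)
  | .nil => by rw [denK]; exact isHom_id
  | .ite K _ _ => by rw [denK]; exact (isHom_denK ρ K).of_elim _ fun _ => rfl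
  | .appR K v => by
    rw [denK]
    exact (isHom_denK ρ K).of_elim _ fun α =>
      congrArg (denK K ρ) (appSem_of_isValue (isValue_denV ρ v) α)
  | .appL K _ => by rw [denK]; exact (isHom_denK ρ K).of_elim _ fun _ => rfl
  | .natopR K _ _ => by rw [denK]; exact (isHom_denK ρ K).of_elim _ fun _ => rfl
  | .natopL K op v => by
    rw [denK]
    exact (isHom_denK ρ K).of_elim _ fun α =>
      congrArg (denK K ρ) (natop_of_isValue op α (isValue_denV ρ v))
  | .kappL K v => by
    rw [denK]
    exact (isHom_denK ρ K).of_elim _ fun α =>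
      congrArg (denK K ρ) (kappSem_of_isValue α (isValue_denV ρ v))
  | .kappR K _ => by rw [denK]; exact (isHom_denK ρ K).of_elim _ fun _ => rfl

theorem denE_val (v : Val) (ρ : Env) : denE (.val v) ρ = denV v ρ := by rw [denE]

theorem denE_app (e₁ e₂ : Expr) (ρ : Env) :
    denE (.app e₁ e₂) ρ = appSem (denE e₁ ρ) (denE e₂ ρ) := by rw [denE]

theorem denE_natop (op : ℕ → ℕ → ℕ) (e₁ e₂ : Expr) (ρ : Env) :
    denE (.natop op e₁ e₂) ρ = natop op (denE e₁ ρ) (denE e₂ ρ) := by rw [denE]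

theorem denE_ite (e e₁ e₂ : Expr) (ρ : Env) :
    denE (.ite e e₁ e₂) ρ = ifte (denE e ρ) (denE e₁ ρ) (denE e₂ ρ) := by rw [denE]

theorem denE_kapp (e₁ e₂ : Expr) (ρ : Env) :
    denE (.kapp e₁ e₂) ρ = kappSem (denE e₁ ρ) (denE e₂ ρ) := by rw [denE]

theorem denV_nat (n : ℕ) (ρ : Env) : denV (.nat n) ρ = Ret n := by rw [denV]; rfl

theorem denE_plug (ρ : Env) : ∀ (K : Ectx) (e : Expr), denE (plug K e) ρ = denK K ρ (denE e ρ)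
  | .nil, e => by rw [plug, denK]; rfl
  | .ite K _ _, e => by rw [plug, denE_plug ρ K, denK, denE_ite]; rfl
  | .appR K _, e => by rw [plug, denE_plug ρ K, denK, denE_app, denE_val]; rfl
  | .appL K _, e => by rw [plug, denE_plug ρ K, denK, denE_app]; rfl
  | .natopR K _ _, e => by rw [plug, denE_plug ρ K, denK, denE_natop]; rfl
  | .natopL K _ _, e => by rw [plug, denE_plug ρ K, denK, denE_natop, denE_val]; rfl
  | .kappL K _, e => by rw [plug, denE_plug ρ K, denK, denE_kapp, denE_val]; rfl
  | .kappR K _, e => by rw [plug, denE_plug ρ K, denK, denE_kapp]; rfl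

/-! ### Renaming and substitution -/

theorem denV_fix_congr {e e' : Expr} {ρ ρ' : Env}
    (h : ∀ α β : DIT, denE e (ext (ext ρ α) β) = denE e' (ext (ext ρ' α) β)) :
    denV (.fix e) ρ = denV (.fix e') ρ' := by
  refine OFE.eq_of_dist fun n => ?_
  induction n using Nat.strong_induction_on with
  | _ n ih =>
    rw [denV_fix_eq e, denV_fix_eq e']
    refine Fun_ne fun m hm v => ?_
    refine dtrans (dist_of_eq (h _ v) m) ?_
    exact (denE e').ne (ext_ne (ext_ne (drefl m ρ') (ih m hm)) (drefl m v))

theorem denE_shift_congr {e e' : Expr} {ρ ρ' : Env}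
    (h : ∀ α : DIT, denE e (ext ρ α) = denE e' (ext ρ' α)) :
    denE (.shift e) ρ = denE (.shift e') ρ' := by
  rw [denE, denE]
  exact congrArg SHIFT (NEHom.ext fun κ => congrArg (fun α => Later.next (popAux α)) (h _))

theorem ext_liftRen (ρ : Env) (α : DIT) (r : ℕ → ℕ) :
    (fun x => ext ρ α (liftRen r x)) = ext (fun x => ρ (r x)) α := by
  funext x; cases x <;> rfl

mutual

theorem denE_renE : ∀ (e : Expr) (r : ℕ → ℕ) (ρ : Env),
    denE (renE e r) ρ = denE e fun x => ρ (r x)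
  | .val v, r, ρ => by rw [renE, denE_val, denE_val, denV_renV v]
  | .var x, r, ρ => by rw [renE, denE, denE]
  | .app e₁ e₂, r, ρ => by
    rw [renE, denE, denE]; exact congrArg₂ appSem (denE_renE e₁ r ρ) (denE_renE e₂ r ρ)
  | .natop op e₁ e₂, r, ρ => by
    rw [renE, denE, denE]; exact congrArg₂ (natop op) (denE_renE e₁ r ρ) (denE_renE e₂ r ρ)
  | .ite e e₁ e₂, r, ρ => by
    rw [renE, denE, denE]; dsimp only; rw [denE_renE e, denE_renE e₁, denE_renE e₂]
  | .shift e, r, ρ => by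
    rw [renE]; exact denE_shift_congr fun α => by rw [denE_renE e, ext_liftRen]
  | .reset e, r, ρ => by
    rw [renE, denE, denE]; exact congrArg resetSem (denE_renE e r ρ)
  | .kapp e₁ e₂, r, ρ => by
    rw [renE, denE, denE]; exact congrArg₂ kappSem (denE_renE e₁ r ρ) (denE_renE e₂ r ρ)

theorem denV_renV : ∀ (v : Val) (r : ℕ → ℕ) (ρ : Env),
    denV (renV v r) ρ = denV v fun x => ρ (r x)
  | .nat n, r, ρ => by rw [renV, denV]; rfl
  | .fix e, r, ρ => by
    rw [renV]; exact denV_fix_congr fun α β => by rw [denE_renE e, ext_liftRen, ext_liftRen]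
  | .cont K, r, ρ => by rw [renV, denV, denV]; exact congrArg contSem (denK_renK K r ρ)

theorem denK_renK : ∀ (K : Ectx) (r : ℕ → ℕ) (ρ : Env),
    denK (renK K r) ρ = denK K fun x => ρ (r x)
  | .nil, r, ρ => by rw [renK, denK]; rfl
  | .ite K e₁ e₂, r, ρ => by
    rw [renK, denK, denK]; refine NEHom.ext fun x => ?_
    dsimp only [frame]; rw [denK_renK K, denE_renE e₁, denE_renE e₂]
  | .appR K v, r, ρ => by
    rw [renK, denK, denK]; refine NEHom.ext fun x => ?_
    dsimp only [frame]; rw [denK_renK K, denV_renV v]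
  | .appL K e, r, ρ => by
    rw [renK, denK, denK]; refine NEHom.ext fun x => ?_
    dsimp only [frame]; rw [denK_renK K, denE_renE e]
  | .natopR K op e, r, ρ => by
    rw [renK, denK, denK]; refine NEHom.ext fun x => ?_
    dsimp only [frame]; rw [denK_renK K, denE_renE e]
  | .natopL K op v, r, ρ => by
    rw [renK, denK, denK]; refine NEHom.ext fun x => ?_
    dsimp only [frame]; rw [denK_renK K, denV_renV v]
  | .kappL K v, r, ρ => by
    rw [renK, denK, denK]; refine NEHom.ext fun x => ?_
    dsimp only [frame]; rw [denK_renK K, denV_renV v]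
  | .kappR K e, r, ρ => by
    rw [renK, denK, denK]; refine NEHom.ext fun x => ?_
    dsimp only [frame]; rw [denK_renK K, denE_renE e]

end

theorem ext_liftSub (ρ : Env) (α : DIT) (s : ℕ → Expr) :
    (fun x => denE (liftSub s x) (ext ρ α)) = ext (fun x => denE (s x) ρ) α := by
  funext x
  cases x with
  | zero => rw [liftSub, denE]; rfl
  | succ x => exact denE_renE (s x) Nat.succ (ext ρ α)

mutual

theorem denE_subE : ∀ (e : Expr) (s : ℕ → Expr) (ρ : Env),
    denE (subE e s) ρ = denE e fun x => denE (s x) ρ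
  | .val v, s, ρ => by rw [subE, denE_val, denE_val, denV_subV v]
  | .var x, s, ρ => by rw [subE, denE]
  | .app e₁ e₂, s, ρ => by
    rw [subE, denE, denE]; exact congrArg₂ appSem (denE_subE e₁ s ρ) (denE_subE e₂ s ρ)
  | .natop op e₁ e₂, s, ρ => by
    rw [subE, denE, denE]; exact congrArg₂ (natop op) (denE_subE e₁ s ρ) (denE_subE e₂ s ρ)
  | .ite e e₁ e₂, s, ρ => by
    rw [subE, denE, denE]; dsimp only; rw [denE_subE e, denE_subE e₁, denE_subE e₂]
  | .shift e, s, ρ => by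
    rw [subE]; exact denE_shift_congr fun α => by rw [denE_subE e, ext_liftSub]
  | .reset e, s, ρ => by
    rw [subE, denE, denE]; exact congrArg resetSem (denE_subE e s ρ)
  | .kapp e₁ e₂, s, ρ => by
    rw [subE, denE, denE]; exact congrArg₂ kappSem (denE_subE e₁ s ρ) (denE_subE e₂ s ρ)

theorem denV_subV : ∀ (v : Val) (s : ℕ → Expr) (ρ : Env),
    denV (subV v s) ρ = denV v fun x => denE (s x) ρ
  | .nat n, s, ρ => by rw [subV, denV]; rfl
  | .fix e, s, ρ => by
    rw [subV]; exact denV_fix_congr fun α β => by rw [denE_subE e, ext_liftSub, ext_liftSub]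
  | .cont K, s, ρ => by rw [subV, denV, denV]; exact congrArg contSem (denK_subK K s ρ)

theorem denK_subK : ∀ (K : Ectx) (s : ℕ → Expr) (ρ : Env),
    denK (subK K s) ρ = denK K fun x => denE (s x) ρ
  | .nil, s, ρ => by rw [subK, denK]; rfl
  | .ite K e₁ e₂, s, ρ => by
    rw [subK, denK, denK]; refine NEHom.ext fun x => ?_
    dsimp only [frame]; rw [denK_subK K, denE_subE e₁, denE_subE e₂]
  | .appR K v, s, ρ => by
    rw [subK, denK, denK]; refine NEHom.ext fun x => ?_
    dsimp only [frame]; rw [denK_subK K, denV_subV v]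
  | .appL K e, s, ρ => by
    rw [subK, denK, denK]; refine NEHom.ext fun x => ?_
    dsimp only [frame]; rw [denK_subK K, denE_subE e]
  | .natopR K op e, s, ρ => by
    rw [subK, denK, denK]; refine NEHom.ext fun x => ?_
    dsimp only [frame]; rw [denK_subK K, denE_subE e]
  | .natopL K op v, s, ρ => by
    rw [subK, denK, denK]; refine NEHom.ext fun x => ?_
    dsimp only [frame]; rw [denK_subK K, denV_subV v]
  | .kappL K v, s, ρ => by
    rw [subK, denK, denK]; refine NEHom.ext fun x => ?_
    dsimp only [frame]; rw [denK_subK K, denV_subV v]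
  | .kappR K e, s, ρ => by
    rw [subK, denK, denK]; refine NEHom.ext fun x => ?_
    dsimp only [frame]; rw [denK_subK K, denE_subE e]

end

theorem denE_subE_inst (e : Expr) (v : Val) (ρ : Env) :
    denE (subE e (inst v)) ρ = denE e (ext ρ (denV v ρ)) := by
  rw [denE_subE]
  congr 1
  funext x
  rcases x with _ | x
  · exact denE_val v ρ
  · rw [inst, denE]; rfl

theorem denE_subE_inst₂ (e : Expr) (v w : Val) (ρ : Env) :
    denE (subE e (inst₂ v w)) ρ = denE e (ext (ext ρ (denV w ρ)) (denV v ρ)) := by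
  rw [denE_subE]
  congr 1
  funext x
  rcases x with _ | _ | x
  · exact denE_val v ρ
  · exact denE_val w ρ
  · rw [inst₂, denE]; rfl

/-! ### Reductions of the denotations of configurations -/

/-- The semantic continuation of an evaluation context. -/
noncomputable def contK (K : Ectx) (ρ : Env) : SCont := Later.map (popAux.comp (denK K ρ))

theorem isHom_popAux_denK (K : Ectx) (ρ : Env) : IsHom (popAux.comp (denK K ρ)) :=
  isHom_popAux.comp (isHom_denK ρ K)

theorem popAux_denK_RESET (K : Ectx) (ρ : Env) (t : Later DIT) :
    popAux (denK K ρ (RESET t)) = Vis (E := sig) Op.reset t (contK K ρ) :=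
  (isHom_popAux_denK K ρ).vis Op.reset t NEHom.id

theorem popAux_denK_SHIFT (K : Ectx) (ρ : Env) (f : SCont -n> Later DIT) :
    popAux (denK K ρ (SHIFT f)) = Vis (E := sig) Op.shift f (contK K ρ) :=
  (isHom_popAux_denK K ρ).vis Op.shift f NEHom.id

theorem popAux_denK_APPCONT (K : Ectx) (ρ : Env) (t : Later DIT) (g : Later (DIT -n> DIT)) :
    popAux (denK K ρ (APPCONT t g)) = Vis (E := sig) Op.appcont (t, g) (contK K ρ) :=
  (isHom_popAux_denK K ρ).vis Op.appcont (t, g) NEHom.id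

end Delim

open GITree GITree.IT Delim in
theorem mainTheorem4 (c₀ c₁ : Delim.Config) (h : Delim.Step c₀ c₁) (ρ : Delim.Env) :
    Relation.ReflTransGen (GITree.IStep Delim.reifier) (Delim.denC c₀ ρ) (Delim.denC c₁ ρ) := by
  cases h with
  | term e => exact .refl
  | mcont_cons K mk v =>
    refine .single ?_
    dsimp only [denC]
    rw [popAux_of_isValue (isValue_denV ρ v), denE_plug, denE_val]
    exact IStep.vis rfl
  | mcont_nil v =>
    refine .single ?_
    dsimp only [denC]
    rw [popAux_of_isValue (isValue_denV ρ v)]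
    exact IStep.vis rfl
  | cont_nil v mk =>
    dsimp only [denC]
    rw [plug, denE_val]
    exact .refl
  | cont_kappL K K' v mk =>
    dsimp only [denC]
    have hK : denE (plug (.kappL K v) (.val (.cont K'))) ρ = denK K ρ (APPCONT
        (.next (denV v ρ)) (.next ⟨fun x => Tick (popAux (denK K' ρ x)),
          fun h => Tau_ne (next_ne (popAux.ne ((denK K' ρ).ne h)))⟩)) := by
      rw [plug, denE_plug, denE_kapp, denE_val, denE_val,
        kappSem_of_isValue _ (isValue_denV ρ v), denV]
      exact congrArg (denK K ρ) (getfun_Fun _ _)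
    rw [hK, popAux_denK_APPCONT, denE_plug, denE_val]
    exact .tail (.single (IStep.vis rfl)) (.tick rfl rfl)
  | cont_kappR K e v mk => exact .refl
  | cont_appL K e v mk => exact .refl
  | cont_appR K e v mk =>
    refine .single (.tick ?_ rfl)
    rw [plug, denE_plug, denE_plug, denE_subE_inst₂, denE_app, denE_val, denE_val]
    conv_lhs => rw [denV_fix_eq]
    rw [appSem_Fun _ (isValue_denV ρ v)]
    exact (isHom_popAux_denK K ρ).tick _
  | cont_natopR K op e v mk => exact .refl
  | cont_natopL K op m n mk =>
    dsimp only [denC]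
    rw [plug, denE_plug, denE_plug, denE_natop, denE_val, denE_val, denE_val, denV_nat, denV_nat,
      denV_nat, natop_Ret]
    exact .refl
  | cont_ite_zero K e₁ e₂ mk =>
    dsimp only [denC]
    rw [plug, denE_plug, denE_plug, denE_ite, denE_val, denV_nat, ifte_Ret, if_pos rfl]
    exact .refl
  | cont_ite_succ K e₁ e₂ n mk =>
    dsimp only [denC]
    rw [plug, denE_plug, denE_plug, denE_ite, denE_val, denV_nat, ifte_Ret, if_neg n.succ_ne_zero]
    exact .refl
  | eval_val v K mk => exact .refl
  | eval_kapp e₀ e₁ K mk => exact .refl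
  | eval_app e₀ e₁ K mk => exact .refl
  | eval_natop op e₀ e₁ K mk => exact .refl
  | eval_ite e e₁ e₂ K mk => exact .refl
  | eval_reset e K mk =>
    refine .single ?_
    dsimp only [denC]
    rw [denE_plug, denE]
    dsimp only [resetSem]
    rw [popAux_denK_RESET]
    exact IStep.vis rfl
  | eval_shift e K mk =>
    refine .single ?_
    dsimp only [denC]
    rw [denE_plug, denE]
    dsimp only [shiftSem]
    rw [popAux_denK_SHIFT, plug, denE_subE_inst, denV]
    exact IStep.vis rfl
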